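/- Let $X$ be a non-negative stochastic process on $\mathbb{R}^d$ with continuous sample paths and law $\mathbb{P}_X$ on $C(\mathbb{R}^d)$. Assume that there are $C,R>0$ with $X\le C\,\mathbf 1_{B_R(o)}$ almost surely, and that there is $r>0$ with $\mathbb{P}_X(X>0 \text{ on } B_r(o))>0$, where $B_R(o)$ is the closed ball of radius $R$ about the origin. Let $\mu_Y>0$, let $\Psi$ be an almost surely strictly positive random field on $\mathbb{R}^d$ with continuous sample paths, and let $N=\sum_{i\ge 1}\delta_{(s_i,u_i,X_i)}$ be a Cox process on $\mathbb{R}^d\times(0,\infty]\times C(\mathbb{R}^d)$ which, conditionally on $\Psi$, is a Poisson process directed by $\mu_Y^{-1}\Psi(s)\,ds\;u^{-2}du\;d\mathbb{P}_X$. Let $Y(t)=\sup_i u_iX_i(t-s_i)$ be the associated Cox extremal process, and let $Y^*$ be a random field with continuous sample paths which, conditionally on $\Psi$, is a copy of $Y$ that is independent of $N$. Let $K\subset\mathbb{R}^d$ be compact and $K_R=K\oplus B_R(o)$. For $y>0$ on $K$ put $$b_K^y(s)=\mu_Y^{-1}\,\mathbb{E}_X\Big[\sup_{t\in K}\frac{X(t-s)}{y(t)}\Big],\qquad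 \psi_K^y(s)=b_K^y(s)\,\Psi(s),\qquad N_K^y=\sum_{i}\delta_{s_i}\mathbf 1\Big\{\sup_{t\in K}\frac{X_i(t-s_i)}{y(t)}\ge u_i^{-1}\Big\}.$$ For a Borel set $D\subset K_R$ and a bandwidth $h>0$ let $$\widehat\psi_D^y(s)=h^{-d}\sum_{t\in N_K^y\cap D}c_D(t)^{-1}k\Big(\frac{s-t}{h}\Big),\qquad c_D(t)=h^{-d}\int_D k\Big(\frac{s-t}{h}\Big)ds,$$ where $k(s)=\frac{d+2}{2c_d}(1-\|s\|^2)\mathbf 1_{B_1(o)}(s)$, $c_d=|B_1(o)|$, is the Epanechnikov kernel. Then $\int_D\widehat\psi_D^y(s)\,ds$ is unbiased for $\int_D\psi_K^y(s)\,ds$, for every bandwidth $h>0$ and every Borel set $D\subset K_R$. Precisely, with all expectations taken in $[0,\infty]$: 1. For every fixed $y$ that is continuous and strictly positive on $K$, almost surely $\int_D\psi_K^y(s)\,ds<\infty$ and $$\mathbb{E}\Big[\int_D\widehat\psi_D^{y}(s)\,ds\,\Big|\,\Psi\Big]=\int_D\psi_K^{y}(s)\,ds,\qquad\text{and}\qquad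 \mathbb{E}\int_D\widehat\psi_D^{y}(s)\,ds=\mathbb{E}\int_D\psi_K^{y}(s)\,ds .$$ 2. For the random threshold $y=Y^*$, almost surely $\int_D\psi_K^{Y^*}(s)\,ds<\infty$, $$\mathbb{E}\Big[\int_D\widehat\psi_D^{Y^*}(s)\,ds\,\Big|\,\Psi,Y^*\Big]=\int_D\psi_K^{Y^*}(s)\,ds ,\qquad \mathbb{E}\Big[\int_D\widehat\psi_D^{Y^*}(s)\,ds\,\Big|\,Y^*\Big]=\mathbb{E}\Big[\int_D\psi_K^{Y^*}(s)\,ds\,\Big|\,Y^*\Big],$$ and $\mathbb{E}\int_D\widehat\psi_D^{Y^*}(s)\,ds=\mathbb{E}\int_D\psi_K^{Y^*}(s)\,ds$. -/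

import Mathlib

open MeasureTheory ProbabilityTheory Set
open scoped ENNReal NNReal Pointwise

namespace CoxExtremal

/-- The space `ℝ^d` with its Euclidean norm. -/
abbrev Space (d : ℕ) : Type := EuclideanSpace ℝ (Fin d)

/-- The space `C(ℝ^d)` of continuous sample paths, with the topology of uniform convergence on
compact sets. -/
abbrev PathSpace (d : ℕ) : Type := C(Space d, ℝ)

/-- `C(ℝ^d)` carries its Borel `σ`-algebra. -/
instance (d : ℕ) : MeasurableSpace (PathSpace d) := borel _

instance (d : ℕ) : BorelSpace (PathSpace d) := ⟨rfl⟩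

/-- The space of marked points `(s, u, X)`: storm centre, severity, shape. The severities live in
`(0, ∞]`, seen inside `[0, ∞]`; the point `0` has measure zero below. -/
abbrev Storm (d : ℕ) : Type := Space d × ℝ≥0∞ × PathSpace d

/-- The measure `u⁻² du` on `(0, ∞]` (it gives no mass to `0` and to `∞`). -/
noncomputable def severityMeasure : Measure ℝ≥0∞ :=
  ((volume.restrict (Ioi (0 : ℝ))).withDensity
    (fun u => ENNReal.ofReal ((u ^ 2)⁻¹))).map ENNReal.ofReal

/-- The directing measure `μY⁻¹ ψ(s) ds u⁻² du dPX` of the marked points, for a realization `ψ` of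
the spatial intensity process. -/
noncomputable def directingMeasure {d : ℕ} (μY : ℝ) (PX : Measure (PathSpace d))
    (ψ : PathSpace d) : Measure (Storm d) :=
  (ENNReal.ofReal μY)⁻¹ •
    ((volume.withDensity (fun s => ENNReal.ofReal (ψ s))).prod (severityMeasure.prod PX))

/-- The point process `∑ i, δ_{p i}` as a random measure. -/
noncomputable def pointProcess {Ω S : Type*} [MeasurableSpace S] (p : ℕ → Ω → S) (ω : Ω) :
    Measure S :=
  Measure.sum (fun i => Measure.dirac (p i ω))

/-- Conditionally on the `σ`-algebra `m`, the random measure `N` is a Poisson process with directing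
measure `Λ`: the numbers of points in finitely many disjoint sets of finite `Λ`-measure are
conditionally independent and Poisson distributed, with the `Λ`-measures as parameters. -/
def IsCoxProcess {Ω S : Type*} (m : MeasurableSpace Ω) [mΩ : MeasurableSpace Ω] [MeasurableSpace S]
    (N : Ω → Measure S) (Λ : Ω → Measure S) (P : Measure Ω) : Prop :=
  ∀ (n : ℕ) (B : Fin n → Set S) (k : Fin n → ℕ),
    (∀ j, MeasurableSet (B j)) → Pairwise (fun i j => Disjoint (B i) (B j)) →
    ∀ᵐ ω ∂P, (∀ j, Λ ω (B j) < ∞) →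
      (P⟦{ω' | ∀ j, N ω' (B j) = (k j : ℝ≥0∞)} | m⟧) ω
        = ∏ j, (poissonMeasure (Λ ω (B j)).toNNReal).real {k j}

/-- The `σ`-algebras `m₁`, `m₂` are conditionally independent given `m`. This is Mathlib's
`ProbabilityTheory.CondIndep`, by its characterization through conditional probabilities, which
makes sense without the assumption that `Ω` is a standard Borel space. -/
def CondIndependent {Ω : Type*} (m m₁ m₂ : MeasurableSpace Ω) [mΩ : MeasurableSpace Ω]
    (P : Measure Ω) : Prop :=
  ∀ A B : Set Ω, MeasurableSet[m₁] A → MeasurableSet[m₂] B →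
    P⟦A ∩ B | m⟧ =ᵐ[P] P⟦A | m⟧ * P⟦B | m⟧

/-- The Cox extremal process `Y(t) = sup_i u_i X_i(t - s_i)`, with values in `[0, ∞]`. -/
noncomputable def extremalProcess {Ω : Type*} {d : ℕ} (p : ℕ → Ω → Storm d) (ω : Ω) (t : Space d) :
    ℝ≥0∞ :=
  ⨆ i, (p i ω).2.1 * ENNReal.ofReal ((p i ω).2.2 (t - (p i ω).1))

/-- The quantity `sup_{t ∈ K} X(t - s) / y(t)`. -/
noncomputable def supRatio {d : ℕ} (K : Set (Space d)) (y : Space d → ℝ) (s : Space d)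
    (x : PathSpace d) : ℝ≥0∞ :=
  ⨆ t ∈ K, ENNReal.ofReal (x (t - s)) / ENNReal.ofReal (y t)

open Classical in
/-- The point process of storm centres contributing on `K` relative to the threshold `y`:
`∑ i, δ_{s_i} 1{sup_{t ∈ K} X_i(t - s_i) / y(t) ≥ 1 / u_i}`. -/
noncomputable def contributing {Ω : Type*} {d : ℕ} (p : ℕ → Ω → Storm d) (K : Set (Space d))
    (y : Space d → ℝ) (ω : Ω) : Measure (Space d) :=
  Measure.sum (fun i =>
    if (p i ω).2.1⁻¹ ≤ supRatio K y (p i ω).1 (p i ω).2.2 then Measure.dirac (p i ω).1 else 0)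

/-- The correcting factor `b_K^y(s) = μY⁻¹ E_X[sup_{t ∈ K} X(t - s) / y(t)]`. -/
noncomputable def correctingFactor {d : ℕ} (μY : ℝ) (PX : Measure (PathSpace d))
    (K : Set (Space d)) (y : Space d → ℝ) (s : Space d) : ℝ≥0∞ :=
  (ENNReal.ofReal μY)⁻¹ * ∫⁻ x, supRatio K y s x ∂PX

/-- The intensity function `ψ_K^y = b_K^y ψ`. -/
noncomputable def contributingIntensity {d : ℕ} (μY : ℝ) (PX : Measure (PathSpace d))
    (K : Set (Space d)) (y : Space d → ℝ) (ψ : PathSpace d) (s : Space d) : ℝ≥0∞ :=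
  correctingFactor μY PX K y s * ENNReal.ofReal (ψ s)

/-- The Epanechnikov kernel `k(s) = (d + 2) / (2 c_d) (1 - ‖s‖²) 1_{B_1(o)}(s)`, where `c_d` is the
volume of the unit ball. -/
noncomputable def epanechnikov (d : ℕ) : Space d → ℝ :=
  (Metric.closedBall (0 : Space d) 1).indicator (fun s =>
    ((d : ℝ) + 2) / (2 * volume.real (Metric.closedBall (0 : Space d) 1)) * (1 - ‖s‖ ^ 2))

/-- The edge correction weight `c_D(t) = h⁻ᵈ ∫_D k((s - t) / h) ds`. -/
noncomputable def edgeWeight {d : ℕ} (h : ℝ) (D : Set (Space d)) (t : Space d) : ℝ≥0∞ :=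
  (ENNReal.ofReal (h ^ d))⁻¹ * ∫⁻ s in D, ENNReal.ofReal (epanechnikov d (h⁻¹ • (s - t)))

/-- The edge-corrected kernel estimator `h⁻ᵈ ∑_{t ∈ η ∩ D} c_D(t)⁻¹ k((s - t) / h)` built on a point
configuration `η`; the sum over the points of `η` in `D` is the integral over `D` with respect to
the counting measure `η`. -/
noncomputable def kernelEstimator {d : ℕ} (h : ℝ) (D : Set (Space d)) (η : Measure (Space d))
    (s : Space d) : ℝ≥0∞ :=
  (ENNReal.ofReal (h ^ d))⁻¹ *
    ∫⁻ t in D, (edgeWeight h D t)⁻¹ * ENNReal.ofReal (epanechnikov d (h⁻¹ • (s - t))) ∂η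

end CoxExtremal

/-!
A Cox process stays a Cox process, with the same directing measure, when one conditions on a further
variable that is conditionally independent of it given `Ψ`. Fixed and random thresholds are thus
instances of one situation: the threshold and `Ψ` are functions of the conditioning variable.

By the edge correction a point `t` of `D` adds `1` to the integral of the kernel estimator over `D`,
whatever the bandwidth. This fails only where the edge weight vanishes, which by Lebesgue's density
theorem happens on a null set. So the integral counts the contributing storms centred in `D`. Since
`u⁻² du` gives mass `r` to `{u | u⁻¹ ≤ r}`, the directing measure of these storms is the integral of
the contributing intensity, and Campbell's formula gives the equality of conditional means.

A supremum over `K` is a supremum over a countable dense subset as soon as the threshold is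
continuous and positive on `K`, which settles measurability. The random threshold is positive
because storms of severity at least `1 / n` have directing measure proportional to `n`: almost
surely every small ball is covered by the region where some storm is positive.
-/

namespace CoxExtremal

section Poisson

theorem tsum_poissonMeasure_singleton (r : ℝ≥0) : ∑' k : ℕ, poissonMeasure r {k} = 1 := by
  simpa using (lintegral_countable' (μ := poissonMeasure r) fun _ => 1).symm

theorem natCast_succ_mul_poissonMeasure_singleton (r : ℝ≥0) (k : ℕ) :
    ((k + 1 : ℕ) : ℝ≥0∞) * poissonMeasure r {k + 1} = r * poissonMeasure r {k} := by
  rw [poissonMeasure_singleton, poissonMeasure_singleton, ← ENNReal.ofReal_natCast,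
    ← ENNReal.ofReal_mul (by positivity), ← ENNReal.ofReal_coe_nnreal (p := r),
    ← ENNReal.ofReal_mul (by positivity), Nat.factorial_succ]
  congr 1
  push_cast
  field_simp
  ring

theorem tsum_natCast_mul_poissonMeasure_singleton (r : ℝ≥0) :
    ∑' k : ℕ, (k : ℝ≥0∞) * poissonMeasure r {k} = r := by
  rw [tsum_eq_zero_add' ENNReal.summable]
  simp_rw [natCast_succ_mul_poissonMeasure_singleton]
  rw [ENNReal.tsum_mul_left, tsum_poissonMeasure_singleton]
  simp

theorem tendsto_poissonMeasure_singleton_zero :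
    Filter.Tendsto (fun r : ℝ≥0 => poissonMeasure r {0}) Filter.atTop (nhds 0) := by
  simp_rw [poissonMeasure_singleton]
  simpa [Function.comp_def] using ENNReal.tendsto_ofReal
    (Real.tendsto_exp_neg_atTop_nhds_zero.comp (NNReal.tendsto_coe_atTop.2 Filter.tendsto_id))

end Poisson

section NatValued

variable {α : Type*} [MeasurableSpace α] {μ : Measure α} {f : α → ℝ≥0∞}

theorem measure_exists_eq_natCast (hf : Measurable f) :
    μ {a | ∃ k : ℕ, f a = k} = ∑' k : ℕ, μ {a | f a = k} := by
  have hlevel (k : ℕ) : MeasurableSet {a | f a = k} := hf (measurableSet_singleton _)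
  rw [ofPred_exists, measure_iUnion _ hlevel]
  intro i j hij
  refine Set.disjoint_left.2 fun a hi hj => hij ?_
  exact_mod_cast (show (i : ℝ≥0∞) = j from hi.symm.trans hj)

theorem lintegral_eq_tsum_natCast_mul (hf : Measurable f) (hnat : ∀ᵐ a ∂μ, ∃ k : ℕ, f a = k) :
    ∫⁻ a, f a ∂μ = ∑' k : ℕ, (k : ℝ≥0∞) * μ {a | f a = k} := by
  have hlevel (k : ℕ) : MeasurableSet {a | f a = k} := hf (measurableSet_singleton _)
  have hsum : ∀ᵐ a ∂μ, f a = ∑' k : ℕ, {a | f a = k}.indicator (fun _ => (k : ℝ≥0∞)) a := by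
    filter_upwards [hnat] with a ⟨k, hk⟩
    rw [tsum_eq_single k, indicator_of_mem (show a ∈ {a | f a = k} from hk), hk]
    intro j hj
    refine indicator_of_notMem (fun hj' => hj ?_) _
    exact_mod_cast (show (j : ℝ≥0∞) = k from hj'.symm.trans hk)
  rw [lintegral_congr_ae hsum,
    lintegral_tsum fun k => (measurable_const.indicator (hlevel k)).aemeasurable]
  simp_rw [lintegral_indicator_const (hlevel _)]

end NatValued

section ConditionalExpectation

theorem isPiSystem_image2_inter {Ω : Type*} {C₁ C₂ : Set (Set Ω)} (h₁ : IsPiSystem C₁)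
    (h₂ : IsPiSystem C₂) : IsPiSystem (image2 (· ∩ ·) C₁ C₂) := by
  rintro _ ⟨E, hE, A, hA, rfl⟩ _ ⟨E', hE', A', hA', rfl⟩ hne
  rw [inter_inter_inter_comm] at hne ⊢
  exact mem_image2_of_mem (h₁ E hE E' hE' hne.left) (h₂ A hA A' hA' hne.right)

theorem generateFrom_image2_inter {Ω : Type*} (m₁ m₂ : MeasurableSpace Ω) :
    MeasurableSpace.generateFrom
      (image2 (· ∩ ·) {E | MeasurableSet[m₁] E} {A | MeasurableSet[m₂] A}) = m₁ ⊔ m₂ := by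
  refine le_antisymm (MeasurableSpace.generateFrom_le ?_) (sup_le ?_ ?_)
  · rintro _ ⟨E, hE, A, hA, rfl⟩
    exact MeasurableSet.inter (le_sup_left (b := m₂) E hE) (le_sup_right (a := m₁) A hA)
  · exact fun E hE => MeasurableSpace.measurableSet_generateFrom
      ⟨E, hE, univ, MeasurableSet.univ, inter_univ E⟩
  · exact fun A hA => MeasurableSpace.measurableSet_generateFrom
      ⟨univ, MeasurableSet.univ, A, hA, univ_inter A⟩

variable {Ω : Type*} {m m₁ m₂ : MeasurableSpace Ω} [mΩ : MeasurableSpace Ω] {P : Measure Ω}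

theorem condLExp_congr_of_setLIntegral_eq [IsFiniteMeasure P] {X Z : Ω → ℝ≥0∞} (hm : m ≤ mΩ)
    (h : ∀ s, MeasurableSet[m] s → ∫⁻ ω in s, X ω ∂P = ∫⁻ ω in s, Z ω ∂P) :
    P⁻[X | m] =ᵐ[P] P⁻[Z | m] := by
  refine ae_eq_condLExp hm P Z (measurable_condLExp m P X) fun s hs => ?_
  rw [setLIntegral_condLExp hm P X hs, h s hs]

theorem setLIntegral_condProb [IsFiniteMeasure P] (hm : m ≤ mΩ) {E F : Set Ω}
    (hE : MeasurableSet[m] E) (hF : MeasurableSet F) :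
    ∫⁻ ω in E, ENNReal.ofReal ((P⟦F | m⟧) ω) ∂P = P (E ∩ F) := by
  have hint : Integrable (F.indicator fun _ => (1 : ℝ)) P := (integrable_const 1).indicator hF
  have hnonneg : 0 ≤ᵐ[P] P⟦F | m⟧ :=
    condExp_nonneg (Filter.Eventually.of_forall fun _ => indicator_nonneg (by simp) _)
  rw [← ofReal_integral_eq_lintegral_ofReal integrable_condExp.integrableOn
    (ae_restrict_of_ae hnonneg), setIntegral_condExp hm hint hE, integral_indicator hF]
  simp [Measure.restrict_apply hF, inter_comm]

theorem ae_eq_condExp_of_isPiSystem [IsFiniteMeasure P] (hm : m ≤ mΩ) {f g : Ω → ℝ}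
    (hf : Integrable f P) (hg : Integrable g P) (hgm : AEStronglyMeasurable[m] g P)
    {C : Set (Set Ω)} (hC : IsPiSystem C) (hmC : m = MeasurableSpace.generateFrom C)
    (huniv : ∫ ω, g ω ∂P = ∫ ω, f ω ∂P)
    (heq : ∀ s ∈ C, ∫ ω in s, g ω ∂P = ∫ ω in s, f ω ∂P) :
    g =ᵐ[P] P[f | m] := by
  refine ae_eq_condExp_of_forall_setIntegral_eq hm hf (fun _ _ _ => hg.integrableOn) ?_ hgm
  suffices h : ∀ s, MeasurableSet[m] s → ∫ ω in s, g ω ∂P = ∫ ω in s, f ω ∂P from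
    fun s hs _ => h s hs
  intro s hs
  induction s, hs using MeasurableSpace.induction_on_inter hmC hC with
  | empty => simp
  | basic s hs => exact heq s hs
  | compl s hs ih => rw [setIntegral_compl (hm s hs) hg, setIntegral_compl (hm s hs) hf, huniv, ih]
  | iUnion s hdisj hs ih =>
    rw [integral_iUnion (fun i => hm _ (hs i)) hdisj hg.integrableOn,
      integral_iUnion (fun i => hm _ (hs i)) hdisj hf.integrableOn]
    exact tsum_congr ih

theorem CondIndependent.setIntegral_condProb [IsFiniteMeasure P]
    (hind : CondIndependent m m₁ m₂ P) (hm : m ≤ mΩ) (hm₁ : m₁ ≤ mΩ) (hm₂ : m₂ ≤ mΩ)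
    {E A F : Set Ω} (hE : MeasurableSet[m] E) (hA : MeasurableSet[m₁] A)
    (hF : MeasurableSet[m₂] F) :
    ∫ ω in E ∩ A, (P⟦F | m⟧) ω ∂P = ∫ ω in E ∩ A, F.indicator (fun _ => (1 : ℝ)) ω ∂P := by
  have hone (B : Set Ω) (hB : MeasurableSet B) : Integrable (B.indicator fun _ => (1 : ℝ)) P :=
    (integrable_const 1).indicator hB
  have hprod : (A.indicator fun _ => (1 : ℝ)) * P⟦F | m⟧ = A.indicator (P⟦F | m⟧) := by
    ext ω
    by_cases hω : ω ∈ A <;> simp [hω]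
  have hint : Integrable ((A.indicator fun _ => (1 : ℝ)) * P⟦F | m⟧) P :=
    hprod ▸ integrable_condExp.indicator (hm₁ A hA)
  have hpull : P[(A.indicator fun _ => (1 : ℝ)) * P⟦F | m⟧ | m] =ᵐ[P] P⟦A ∩ F | m⟧ :=
    (condExp_mul_of_stronglyMeasurable_right stronglyMeasurable_condExp hint
      (hone A (hm₁ A hA))).trans (hind A F hA hF).symm
  calc ∫ ω in E ∩ A, (P⟦F | m⟧) ω ∂P
      = ∫ ω in E, ((A.indicator fun _ => (1 : ℝ)) * P⟦F | m⟧) ω ∂P := by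
        rw [hprod, setIntegral_indicator (hm₁ A hA)]
    _ = ∫ ω in E, (P⟦A ∩ F | m⟧) ω ∂P := by
        rw [← setIntegral_condExp hm hint hE]
        exact setIntegral_congr_ae (hm E hE) (hpull.mono fun ω hω _ => hω)
    _ = ∫ ω in E ∩ A, F.indicator (fun _ => (1 : ℝ)) ω ∂P := by
        rw [setIntegral_condExp hm (hone _ ((hm₁ A hA).inter (hm₂ F hF))) hE,
          ← indicator_indicator, setIntegral_indicator (hm₁ A hA)]

theorem CondIndependent.condProb_sup [IsFiniteMeasure P] (hind : CondIndependent m m₁ m₂ P)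
    (hm : m ≤ mΩ) (hm₁ : m₁ ≤ mΩ) (hm₂ : m₂ ≤ mΩ) {F : Set Ω} (hF : MeasurableSet[m₂] F) :
    P⟦F | m ⊔ m₁⟧ =ᵐ[P] P⟦F | m⟧ := by
  have hint : Integrable (F.indicator fun _ => (1 : ℝ)) P :=
    (integrable_const 1).indicator (hm₂ F hF)
  refine (ae_eq_condExp_of_isPiSystem (sup_le hm hm₁) hint integrable_condExp
    (stronglyMeasurable_condExp.mono (le_sup_left (b := m₁))).aestronglyMeasurable
    (isPiSystem_image2_inter (@MeasurableSpace.isPiSystem_measurableSet _ m)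
      (@MeasurableSpace.isPiSystem_measurableSet _ m₁))
    (generateFrom_image2_inter m m₁).symm (integral_condExp hm) ?_).symm
  rintro _ ⟨E, hE, A, hA, rfl⟩
  exact hind.setIntegral_condProb hm hm₁ hm₂ hE hA hF

end ConditionalExpectation

section CoxProcess

variable {Ω S : Type*} {m m₁ : MeasurableSpace Ω} [mΩ : MeasurableSpace Ω] [MeasurableSpace S]
  {P : Measure Ω} {N Λ : Ω → Measure S} {B : Set S}

theorem IsCoxProcess.sup [IsFiniteMeasure P] (hN : IsCoxProcess m N Λ P)
    (hind : CondIndependent m m₁ (MeasurableSpace.comap N inferInstance) P)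
    (hm : m ≤ mΩ) (hm₁ : m₁ ≤ mΩ) (hNm : Measurable N) : IsCoxProcess (m ⊔ m₁) N Λ P := by
  intro n B k hB hdisj
  have hcounts : MeasurableSet[MeasurableSpace.comap N inferInstance]
      {ω | ∀ j, N ω (B j) = (k j : ℝ≥0∞)} := by
    refine ⟨{ν | ∀ j, ν (B j) = (k j : ℝ≥0∞)}, ?_, rfl⟩
    exact measurableSet_setOfPred.2 (Measurable.forall fun j =>
      (Measure.measurable_coe (hB j)).eq_const _)
  filter_upwards [hN n B k hB hdisj, hind.condProb_sup hm hm₁ hNm.comap_le hcounts]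
    with ω hω hsup hfin
  rw [hsup, hω hfin]

theorem IsCoxProcess.comap_prodMk [IsFiniteMeasure P] {Z W : Type*} [MeasurableSpace Z]
    [MeasurableSpace W] {V : Ω → Z} {Y : Ω → W}
    (hN : IsCoxProcess (MeasurableSpace.comap V inferInstance) N Λ P) (hV : Measurable V)
    (hY : Measurable Y) (hNm : Measurable N)
    (hind : CondIndependent (MeasurableSpace.comap V inferInstance)
      (MeasurableSpace.comap Y inferInstance) (MeasurableSpace.comap N inferInstance) P) :
    IsCoxProcess (MeasurableSpace.comap (fun ω => (V ω, Y ω)) inferInstance) N Λ P := by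
  rw [show MeasurableSpace.comap (fun ω => (V ω, Y ω)) inferInstance
    = MeasurableSpace.comap V inferInstance ⊔ MeasurableSpace.comap Y inferInstance from
    MeasurableSpace.comap_prodMk V Y]
  exact hN.sup hind hV.comap_le hY.comap_le hNm

theorem IsCoxProcess.condProb_count (hN : IsCoxProcess m N Λ P) (hB : MeasurableSet B)
    (hfin : ∀ᵐ ω ∂P, Λ ω B < ∞) (k : ℕ) :
    P⟦{ω | N ω B = (k : ℝ≥0∞)} | m⟧
      =ᵐ[P] fun ω => (poissonMeasure (Λ ω B).toNNReal).real {k} := by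
  filter_upwards [hfin, hN 1 (fun _ => B) (fun _ => k) (fun _ => hB)
    fun i j hij => (hij (Subsingleton.elim i j)).elim] with ω hω hcount
  simpa using hcount fun _ => hω

theorem IsCoxProcess.ofReal_condProb_count (hN : IsCoxProcess m N Λ P) (hB : MeasurableSet B)
    (hfin : ∀ᵐ ω ∂P, Λ ω B < ∞) (k : ℕ) :
    (fun ω => ENNReal.ofReal ((P⟦{ω | N ω B = (k : ℝ≥0∞)} | m⟧) ω))
      =ᵐ[P] fun ω => poissonMeasure (Λ ω B).toNNReal {k} := by
  filter_upwards [hN.condProb_count hB hfin k] with ω hω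
  rw [hω, ofReal_measureReal]

theorem IsCoxProcess.aemeasurable_poissonMeasure (hN : IsCoxProcess m N Λ P)
    (hm : m ≤ mΩ) (hB : MeasurableSet B) (hfin : ∀ᵐ ω ∂P, Λ ω B < ∞) (k : ℕ) :
    AEMeasurable (fun ω => poissonMeasure (Λ ω B).toNNReal {k}) P :=
  ((stronglyMeasurable_condExp.mono hm).measurable.ennreal_ofReal.aemeasurable).congr
    (hN.ofReal_condProb_count hB hfin k)

theorem IsCoxProcess.measure_inter_count [IsFiniteMeasure P] (hN : IsCoxProcess m N Λ P)
    (hm : m ≤ mΩ) (hNm : Measurable N) (hB : MeasurableSet B) (hfin : ∀ᵐ ω ∂P, Λ ω B < ∞)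
    {E : Set Ω} (hE : MeasurableSet[m] E) (k : ℕ) :
    P (E ∩ {ω | N ω B = k}) = ∫⁻ ω in E, poissonMeasure (Λ ω B).toNNReal {k} ∂P := by
  have hcount : MeasurableSet {ω | N ω B = k} :=
    ((Measure.measurable_coe hB).comp hNm) (measurableSet_singleton _)
  rw [← setLIntegral_condProb hm hE hcount]
  exact lintegral_congr_ae (ae_restrict_of_ae (hN.ofReal_condProb_count hB hfin k))

theorem IsCoxProcess.ae_exists_count_eq [IsFiniteMeasure P] (hN : IsCoxProcess m N Λ P)
    (hm : m ≤ mΩ) (hNm : Measurable N) (hB : MeasurableSet B) (hfin : ∀ᵐ ω ∂P, Λ ω B < ∞) :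
    ∀ᵐ ω ∂P, ∃ k : ℕ, N ω B = k := by
  have hcount : Measurable fun ω => N ω B := (Measure.measurable_coe hB).comp hNm
  have hmeas : MeasurableSet {ω | ∃ k : ℕ, N ω B = k} :=
    measurableSet_setOfPred.2 (Measurable.exists fun k => hcount.eq_const _)
  refine (ae_iff_measure_eq hmeas.nullMeasurableSet).2 ?_
  calc P {ω | ∃ k : ℕ, N ω B = k}
      = ∑' k : ℕ, ∫⁻ ω, poissonMeasure (Λ ω B).toNNReal {k} ∂P := by
        rw [measure_exists_eq_natCast hcount]
        refine tsum_congr fun k => ?_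
        simpa using hN.measure_inter_count hm hNm hB hfin MeasurableSet.univ k
    _ = P univ := by
        rw [← lintegral_tsum (hN.aemeasurable_poissonMeasure hm hB hfin)]
        simp only [tsum_poissonMeasure_singleton, lintegral_one]

theorem IsCoxProcess.setLIntegral_count [IsFiniteMeasure P] (hN : IsCoxProcess m N Λ P)
    (hm : m ≤ mΩ) (hNm : Measurable N) (hB : MeasurableSet B) (hfin : ∀ᵐ ω ∂P, Λ ω B < ∞)
    {E : Set Ω} (hE : MeasurableSet[m] E) :
    ∫⁻ ω in E, N ω B ∂P = ∫⁻ ω in E, Λ ω B ∂P := by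
  have hcount : Measurable fun ω => N ω B := (Measure.measurable_coe hB).comp hNm
  have hlevel (k : ℕ) : MeasurableSet {ω | N ω B = k} := hcount (measurableSet_singleton _)
  have hpoisson (k : ℕ) :
      AEMeasurable (fun ω => poissonMeasure (Λ ω B).toNNReal {k}) (P.restrict E) :=
    (hN.aemeasurable_poissonMeasure hm hB hfin k).restrict
  calc ∫⁻ ω in E, N ω B ∂P
      = ∑' k : ℕ, k * P (E ∩ {ω | N ω B = k}) := by
        rw [lintegral_eq_tsum_natCast_mul hcount
          (ae_restrict_of_ae (hN.ae_exists_count_eq hm hNm hB hfin))]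
        simp_rw [Measure.restrict_apply (hlevel _), inter_comm E]
    _ = ∫⁻ ω in E, ∑' k : ℕ, k * poissonMeasure (Λ ω B).toNNReal {k} ∂P := by
        rw [lintegral_tsum fun k => (hpoisson k).const_mul _]
        refine tsum_congr fun k => ?_
        rw [lintegral_const_mul'' _ (hpoisson k), hN.measure_inter_count hm hNm hB hfin hE]
    _ = ∫⁻ ω in E, Λ ω B ∂P := by
        refine lintegral_congr_ae (ae_restrict_of_ae ?_)
        filter_upwards [hfin] with ω hω
        rw [tsum_natCast_mul_poissonMeasure_singleton, ENNReal.coe_toNNReal hω.ne]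

theorem IsCoxProcess.ae_ne_zero_of_tendsto_top [IsFiniteMeasure P] (hN : IsCoxProcess m N Λ P)
    (hm : m ≤ mΩ) (hNm : Measurable N) {A : Set S} {B : ℕ → Set S}
    (hB : ∀ n, MeasurableSet (B n)) (hBA : ∀ n, B n ⊆ A)
    (hfin : ∀ n, ∀ᵐ ω ∂P, Λ ω (B n) < ∞)
    (htop : ∀ᵐ ω ∂P, Filter.Tendsto (fun n => Λ ω (B n)) Filter.atTop (nhds ∞)) :
    ∀ᵐ ω ∂P, N ω A ≠ 0 := by
  have hvoid : Filter.Tendsto (fun n => ∫⁻ ω, poissonMeasure (Λ ω (B n)).toNNReal {0} ∂P)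
      Filter.atTop (nhds (∫⁻ _, 0 ∂P)) := by
    refine tendsto_lintegral_of_dominated_convergence' 1
      (fun n => hN.aemeasurable_poissonMeasure hm (hB n) (hfin n) 0)
      (fun n => Filter.Eventually.of_forall fun ω => prob_le_one) (by simp) ?_
    filter_upwards [htop, ae_all_iff.2 hfin] with ω hω hωfin
    refine tendsto_poissonMeasure_singleton_zero.comp (Filter.tendsto_atTop.2 fun r => ?_)
    filter_upwards [hω.eventually (lt_mem_nhds (ENNReal.coe_lt_top (r := r)))] with n hn
    exact ENNReal.le_toNNReal_of_coe_le hn.le (hωfin n).ne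
  rw [lintegral_zero] at hvoid
  refine measure_mono_null (fun ω hω => not_not.1 hω) (le_antisymm (ge_of_tendsto' hvoid
    fun n => ?_) bot_le : P {ω | N ω A = 0} = 0)
  calc P {ω | N ω A = 0}
      ≤ P {ω | N ω (B n) = (0 : ℕ)} :=
        measure_mono fun ω hω => by simpa using measure_mono_null (hBA n) hω
    _ = ∫⁻ ω, poissonMeasure (Λ ω (B n)).toNNReal {0} ∂P := by
        simpa using hN.measure_inter_count hm hNm (hB n) (hfin n) MeasurableSet.univ 0

end CoxProcess

section PointProcess

variable {Ω Z S : Type*} [MeasurableSpace Ω] [MeasurableSpace Z] [MeasurableSpace S]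
  {P : Measure Ω} {V : Ω → Z} {p : ℕ → Ω → S} {κ : Kernel Z S}

theorem pointProcess_apply {Ω : Type*} (p : ℕ → Ω → S) (ω : Ω) {B : Set S} (hB : MeasurableSet B) :
    pointProcess p ω B = ∑' i, B.indicator 1 (p i ω) := by
  simp_rw [pointProcess, Measure.sum_apply _ hB, Measure.dirac_apply' _ hB]

theorem measurable_pointProcess (hp : ∀ i, Measurable (p i)) : Measurable (pointProcess p) := by
  refine Measure.measurable_of_measurable_coe _ fun B hB => ?_
  simp_rw [pointProcess_apply p _ hB]
  exact Measurable.tsum fun i => (measurable_one.indicator hB).comp (hp i)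

theorem exists_mem_of_pointProcess_ne_zero {Ω : Type*} {p : ℕ → Ω → S} {ω : Ω} {A : Set S}
    (hA : MeasurableSet A) (h : pointProcess p ω A ≠ 0) : ∃ i, p i ω ∈ A := by
  contrapose! h
  simp [pointProcess_apply p ω hA, h]

theorem sum_map_prodMk_apply (hV : Measurable V) (hp : ∀ i, Measurable (p i)) {G : Set (Z × S)}
    (hG : MeasurableSet G) :
    Measure.sum (fun i => P.map fun ω => (V ω, p i ω)) G
      = ∫⁻ ω, pointProcess p ω (Prod.mk (V ω) ⁻¹' G) ∂P := by
  have hpair (i : ℕ) : Measurable fun ω => (V ω, p i ω) := hV.prodMk (hp i)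
  have hmem (i : ℕ) : Measurable fun ω =>
      (Prod.mk (V ω) ⁻¹' G).indicator (1 : S → ℝ≥0∞) (p i ω) :=
    (measurable_one.indicator hG).comp (hpair i)
  simp_rw [pointProcess_apply p _ (measurable_prodMk_left hG)]
  rw [lintegral_tsum fun i => (hmem i).aemeasurable, Measure.sum_apply _ hG]
  refine tsum_congr fun i => ?_
  rw [Measure.map_apply (hpair i) hG, ← lintegral_indicator_one (hpair i hG)]
  rfl

theorem map_compProd_apply [SFinite P] [IsSFiniteKernel κ] (hV : Measurable V) {G : Set (Z × S)}
    (hG : MeasurableSet G) :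
    (P.map V ⊗ₘ κ) G = ∫⁻ ω, κ (V ω) (Prod.mk (V ω) ⁻¹' G) ∂P := by
  rw [Measure.compProd_apply hG, lintegral_map (Kernel.measurable_kernel_prodMk_left hG) hV]

theorem lintegral_measure_preimage_prod (ν : Ω → Measure S) (hV : Measurable V) {E : Set Z}
    (hE : MeasurableSet E) (C : Set S) :
    ∫⁻ ω, ν ω (Prod.mk (V ω) ⁻¹' E ×ˢ C) ∂P = ∫⁻ ω in V ⁻¹' E, ν ω C ∂P := by
  rw [← lintegral_indicator (hV hE)]
  refine lintegral_congr fun ω => ?_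
  by_cases hω : V ω ∈ E <;> simp [hω]

theorem IsCoxProcess.sum_map_prodMk_prod [IsFiniteMeasure P] [IsSFiniteKernel κ]
    (hN : IsCoxProcess (MeasurableSpace.comap V inferInstance) (pointProcess p)
      (fun ω => κ (V ω)) P)
    (hV : Measurable V) (hp : ∀ i, Measurable (p i)) {E : Set Z} (hE : MeasurableSet E) {C : Set S}
    (hC : MeasurableSet C) (hfin : ∀ z, κ z C < ∞) :
    Measure.sum (fun i => P.map fun ω => (V ω, p i ω)) (E ×ˢ C) = (P.map V ⊗ₘ κ) (E ×ˢ C) := by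
  rw [sum_map_prodMk_apply hV hp (hE.prod hC), map_compProd_apply hV (hE.prod hC),
    lintegral_measure_preimage_prod _ hV hE, lintegral_measure_preimage_prod _ hV hE]
  exact hN.setLIntegral_count hV.comap_le (measurable_pointProcess hp) hC
    (Filter.Eventually.of_forall fun _ => hfin _) ⟨E, hE, rfl⟩

theorem compProd_prod_lt_top {μ : Measure Z} [IsFiniteMeasure μ] [IsSFiniteKernel κ]
    {E : Set Z} (hE : MeasurableSet E) {C : Set S} (hC : MeasurableSet C) {c : ℝ≥0∞} (hc : c < ∞)
    (hκ : ∀ z ∈ E, κ z C ≤ c) : (μ ⊗ₘ κ) (E ×ˢ C) < ∞ := by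
  rw [Measure.compProd_apply_prod hE hC]
  calc ∫⁻ z in E, κ z C ∂μ ≤ ∫⁻ _ in E, c ∂μ := setLIntegral_mono measurable_const hκ
    _ < ∞ := by
      rw [setLIntegral_const]
      exact ENNReal.mul_lt_top hc (measure_lt_top μ E)

-- Both sides are σ-finite: `κ z (B n)` is bounded on each of the rectangles
-- `{z | κ z (B n) ≤ k} × B n`, which cover `Z × S`.
theorem IsCoxProcess.sum_map_prodMk_eq_compProd [IsFiniteMeasure P] [IsSFiniteKernel κ]
    (hN : IsCoxProcess (MeasurableSpace.comap V inferInstance) (pointProcess p)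
      (fun ω => κ (V ω)) P)
    (hV : Measurable V) (hp : ∀ i, Measurable (p i)) {B : ℕ → Set S}
    (hB : ∀ n, MeasurableSet (B n)) (hfin : ∀ n z, κ z (B n) < ∞) (hcover : ⋃ n, B n = univ) :
    Measure.sum (fun i => P.map fun ω => (V ω, p i ω)) = P.map V ⊗ₘ κ := by
  let L : ℕ × ℕ → Set Z := fun nk => {z | κ z (B nk.1) ≤ nk.2}
  have hL (nk) : MeasurableSet (L nk) := measurableSet_le (κ.measurable_coe (hB _)) measurable_const
  have hLcover : ⋃ nk, L nk ×ˢ B nk.1 = univ := by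
    refine eq_univ_of_forall fun ⟨z, q⟩ => ?_
    obtain ⟨n, hn⟩ := mem_iUnion.1 (hcover ▸ mem_univ q : q ∈ ⋃ n, B n)
    obtain ⟨k, hk⟩ := ENNReal.exists_nat_gt (hfin n z).ne
    exact mem_iUnion.2 ⟨(n, k), hk.le, hn⟩
  refine (Measure.ext_iff_of_iUnion_eq_univ hLcover).2 fun nk => ?_
  have hrect {E : Set Z} {C : Set S} (hE : MeasurableSet E) (hC : MeasurableSet C) :
      (Measure.sum fun i => P.map fun ω => (V ω, p i ω)).restrict (L nk ×ˢ B nk.1) (E ×ˢ C)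
        = (P.map V ⊗ₘ κ).restrict (L nk ×ˢ B nk.1) (E ×ˢ C) := by
    rw [Measure.restrict_apply (hE.prod hC), Measure.restrict_apply (hE.prod hC), prod_inter_prod]
    exact hN.sum_map_prodMk_prod hV hp (hE.inter (hL nk)) (hC.inter (hB _))
      fun z => (measure_mono inter_subset_right).trans_lt (hfin _ z)
  have : IsFiniteMeasure
      ((Measure.sum fun i => P.map fun ω => (V ω, p i ω)).restrict (L nk ×ˢ B nk.1)) := by
    refine ⟨?_⟩
    rw [← univ_prod_univ, hrect .univ .univ, Measure.restrict_apply (.prod .univ .univ),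
      univ_prod_univ, univ_inter]
    exact compProd_prod_lt_top (hL nk) (hB _) (ENNReal.natCast_lt_top nk.2) fun _ => id
  exact Measure.ext_prod hrect

theorem IsCoxProcess.setLIntegral_pointProcess_preimage [IsFiniteMeasure P] [IsSFiniteKernel κ]
    (hN : IsCoxProcess (MeasurableSpace.comap V inferInstance) (pointProcess p)
      (fun ω => κ (V ω)) P)
    (hV : Measurable V) (hp : ∀ i, Measurable (p i)) {B : ℕ → Set S}
    (hB : ∀ n, MeasurableSet (B n)) (hfin : ∀ n z, κ z (B n) < ∞) (hcover : ⋃ n, B n = univ)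
    {G : Set (Z × S)} (hG : MeasurableSet G) {s : Set Ω}
    (hs : MeasurableSet[MeasurableSpace.comap V inferInstance] s) :
    ∫⁻ ω in s, pointProcess p ω (Prod.mk (V ω) ⁻¹' G) ∂P
      = ∫⁻ ω in s, κ (V ω) (Prod.mk (V ω) ⁻¹' G) ∂P := by
  obtain ⟨E, hE, rfl⟩ := hs
  have hsection (ν : Ω → Measure S) :
      ∫⁻ ω in V ⁻¹' E, ν ω (Prod.mk (V ω) ⁻¹' G) ∂P
        = ∫⁻ ω, ν ω (Prod.mk (V ω) ⁻¹' (G ∩ E ×ˢ univ)) ∂P := by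
    rw [← lintegral_indicator (hV hE)]
    refine lintegral_congr fun ω => ?_
    by_cases hω : V ω ∈ E <;> simp [hω]
  have hGE := hG.inter (hE.prod MeasurableSet.univ)
  rw [hsection, hsection, ← sum_map_prodMk_apply hV hp hGE,
    hN.sum_map_prodMk_eq_compProd hV hp hB hfin hcover, map_compProd_apply hV hGE]

end PointProcess

section Severity

instance : SFinite severityMeasure := by
  unfold severityMeasure
  infer_instance

theorem severityMeasure_apply {B : Set ℝ≥0∞} (hB : MeasurableSet B) :
    severityMeasure B
      = ∫⁻ u in Ioi (0 : ℝ) ∩ ENNReal.ofReal ⁻¹' B, ENNReal.ofReal ((u ^ 2)⁻¹) := by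
  have hB' := ENNReal.measurable_ofReal hB
  rw [severityMeasure, Measure.map_apply ENNReal.measurable_ofReal hB, withDensity_apply _ hB',
    Measure.restrict_restrict hB', inter_comm]

theorem lintegral_Ici_inv_sq {a : ℝ} (ha : 0 < a) :
    ∫⁻ u in Ici a, ENNReal.ofReal ((u ^ 2)⁻¹) = ENNReal.ofReal a⁻¹ := by
  have hpos : ∀ᵐ u ∂volume.restrict (Ioi a), 0 < u :=
    (ae_restrict_mem measurableSet_Ioi).mono fun u hu => ha.trans hu
  have hrpow : ∀ᵐ u ∂volume.restrict (Ioi a), u ^ (-2 : ℝ) = (u ^ 2)⁻¹ := by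
    filter_upwards [hpos] with u hu
    rw [Real.rpow_neg hu.le, Real.rpow_two]
  calc ∫⁻ u in Ici a, ENNReal.ofReal ((u ^ 2)⁻¹)
      = ∫⁻ u in Ioi a, ENNReal.ofReal (u ^ (-2 : ℝ)) := by
        rw [← restrict_Ioi_eq_restrict_Ici]
        exact lintegral_congr_ae (hrpow.mono fun u hu => congrArg ENNReal.ofReal hu.symm)
    _ = ENNReal.ofReal (∫ u in Ioi a, u ^ (-2 : ℝ)) :=
        (ofReal_integral_eq_lintegral_ofReal (integrableOn_Ioi_rpow_of_lt (by norm_num) ha)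
          (hpos.mono fun u hu => Real.rpow_nonneg hu.le _)).symm
    _ = ENNReal.ofReal a⁻¹ := by
        rw [integral_Ioi_rpow_of_lt (by norm_num) ha]
        norm_num [Real.rpow_neg_one]

theorem measurableSet_inv_le (r : ℝ≥0∞) : MeasurableSet {u : ℝ≥0∞ | u⁻¹ ≤ r} :=
  measurableSet_le measurable_inv measurable_const

theorem severityMeasure_inv_le_ofReal {r : ℝ} (hr : 0 < r) :
    severityMeasure {u | u⁻¹ ≤ ENNReal.ofReal r} = ENNReal.ofReal r := by
  have hray : Ioi (0 : ℝ) ∩ ENNReal.ofReal ⁻¹' {u | u⁻¹ ≤ ENNReal.ofReal r} = Ici r⁻¹ := by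
    ext u
    have hiff (hu : 0 < u) : (ENNReal.ofReal u)⁻¹ ≤ ENNReal.ofReal r ↔ r⁻¹ ≤ u := by
      rw [← ENNReal.ofReal_inv_of_pos hu, ENNReal.ofReal_le_ofReal_iff hr.le, inv_le_comm₀ hu hr]
    exact ⟨fun hu => (hiff hu.1).1 hu.2,
      fun hu => ⟨(inv_pos.2 hr).trans_le hu, (hiff ((inv_pos.2 hr).trans_le hu)).2 hu⟩⟩
  rw [severityMeasure_apply (measurableSet_inv_le _), hray, lintegral_Ici_inv_sq (inv_pos.2 hr),
    inv_inv]

theorem severityMeasure_inv_le (r : ℝ≥0∞) : severityMeasure {u | u⁻¹ ≤ r} = r := by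
  induction r with
  | top =>
    refine ENNReal.eq_top_of_forall_nnreal_le fun x => ?_
    calc (x : ℝ≥0∞) ≤ ENNReal.ofReal (x + 1) := by
          rw [← ENNReal.ofReal_coe_nnreal]
          exact ENNReal.ofReal_le_ofReal (by linarith)
      _ = severityMeasure {u | u⁻¹ ≤ ENNReal.ofReal (x + 1)} :=
          (severityMeasure_inv_le_ofReal (by positivity)).symm
      _ ≤ severityMeasure {u | u⁻¹ ≤ ∞} := measure_mono fun u _ => (le_top : u⁻¹ ≤ ∞)
  | coe r =>
    rcases eq_zero_or_pos r with rfl | hr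
    · have hempty : ENNReal.ofReal ⁻¹' {u | u⁻¹ ≤ ((0 : ℝ≥0) : ℝ≥0∞)} = ∅ :=
        eq_empty_of_forall_notMem fun u hu => by simp at hu
      rw [severityMeasure_apply (measurableSet_inv_le _), hempty]
      simp
    · rw [← ENNReal.ofReal_coe_nnreal]
      exact severityMeasure_inv_le_ofReal hr

theorem severityMeasure_singleton_zero : severityMeasure {0} = 0 := by
  have hempty : Ioi (0 : ℝ) ∩ ENNReal.ofReal ⁻¹' {0} = ∅ :=
    eq_empty_of_forall_notMem fun _ hu => hu.1.not_ge (ENNReal.ofReal_eq_zero.1 hu.2)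
  rw [severityMeasure_apply (measurableSet_singleton _), hempty]
  simp

end Severity

section Epanechnikov

variable {d : ℕ} {h : ℝ}

theorem measurable_epanechnikov : Measurable (epanechnikov d) := by
  unfold epanechnikov
  exact Measurable.indicator (by fun_prop) Metric.isClosed_closedBall.measurableSet

theorem epanechnikov_pos {s : Space d} (hs : ‖s‖ < 1) : 0 < epanechnikov d s := by
  have hball : 0 < volume.real (Metric.closedBall (0 : Space d) 1) :=
    ENNReal.toReal_pos (Metric.measure_closedBall_pos volume _ one_pos).ne'
      measure_closedBall_lt_top.ne
  have hprofile : 0 < 1 - ‖s‖ ^ 2 := by nlinarith [norm_nonneg s]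
  rw [epanechnikov, indicator_of_mem (by simpa using hs.le)]
  positivity

theorem epanechnikov_le_indicator (s : Space d) : epanechnikov d s
    ≤ (Metric.closedBall (0 : Space d) 1).indicator
      (fun _ => ((d : ℝ) + 2) / (2 * volume.real (Metric.closedBall (0 : Space d) 1))) s := by
  unfold epanechnikov
  refine indicator_le_indicator ?_
  exact mul_le_of_le_one_right (by positivity) (by nlinarith [sq_nonneg ‖s‖])

theorem measurable_epanechnikov_scaled (h : ℝ) :
    Measurable fun z : Space d × Space d =>
      ENNReal.ofReal (epanechnikov d (h⁻¹ • (z.1 - z.2))) := by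
  have := measurable_epanechnikov (d := d)
  fun_prop

theorem measurable_edgeWeight (h : ℝ) (D : Set (Space d)) : Measurable (edgeWeight h D) :=
  ((measurable_epanechnikov_scaled h).lintegral_prod_left (μ := volume.restrict D)).const_mul _

theorem edgeWeight_lt_top (hh : 0 < h) (D : Set (Space d)) (t : Space d) :
    edgeWeight h D t < ∞ := by
  set c := ((d : ℝ) + 2) / (2 * volume.real (Metric.closedBall (0 : Space d) 1))
  have hle (s : Space d) : ENNReal.ofReal (epanechnikov d (h⁻¹ • (s - t)))
      ≤ (Metric.closedBall t h).indicator (fun _ => ENNReal.ofReal c) s := by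
    have hmem : h⁻¹ • (s - t) ∈ Metric.closedBall (0 : Space d) 1 ↔ s ∈ Metric.closedBall t h := by
      rw [mem_closedBall_zero_iff, norm_smul, norm_inv, Real.norm_of_nonneg hh.le,
        inv_mul_le_iff₀ hh, mul_one, ← dist_eq_norm, Metric.mem_closedBall]
    refine (ENNReal.ofReal_le_ofReal (epanechnikov_le_indicator _)).trans_eq ?_
    by_cases hs : s ∈ Metric.closedBall t h
    · rw [indicator_of_mem (hmem.2 hs), indicator_of_mem hs]
    · rw [indicator_of_notMem (mt hmem.1 hs), indicator_of_notMem hs, ENNReal.ofReal_zero]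
  refine ENNReal.mul_lt_top (by simp [pow_pos hh]) ?_
  calc ∫⁻ s in D, ENNReal.ofReal (epanechnikov d (h⁻¹ • (s - t)))
      ≤ ∫⁻ s, (Metric.closedBall t h).indicator (fun _ => ENNReal.ofReal c) s :=
        (setLIntegral_le_lintegral _ _).trans (lintegral_mono hle)
    _ < ∞ := by
        rw [lintegral_indicator_const Metric.isClosed_closedBall.measurableSet]
        exact ENNReal.mul_lt_top ENNReal.ofReal_lt_top measure_closedBall_lt_top

-- If the edge weight vanishes at `t`, then `D` has no mass in the ball of radius `h` about `t`.
theorem volume_edgeWeight_eq_zero (hh : 0 < h) {D : Set (Space d)} (hD : MeasurableSet D) :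
    volume ({t | edgeWeight h D t = 0} ∩ D) = 0 := by
  refine measure_null_of_locally_null _ fun t ht =>
    ⟨{t | edgeWeight h D t = 0} ∩ D ∩ Metric.ball t h, inter_mem_nhdsWithin _
      (Metric.ball_mem_nhds t hh), ?_⟩
  have hker : Measurable fun s : Space d => ENNReal.ofReal (epanechnikov d (h⁻¹ • (s - t))) := by
    have := measurable_epanechnikov (d := d)
    fun_prop
  have hzero : ∫⁻ s in D, ENNReal.ofReal (epanechnikov d (h⁻¹ • (s - t))) = 0 :=
    (mul_eq_zero.1 ht.1).resolve_left (by simp)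
  rw [lintegral_eq_zero_iff hker, Filter.EventuallyEq, ae_restrict_iff' hD] at hzero
  refine measure_mono_null (fun s hs => ?_) hzero
  intro hs'
  refine (epanechnikov_pos ?_).not_ge (ENNReal.ofReal_eq_zero.1 (hs' hs.1.2))
  rw [norm_smul, norm_inv, Real.norm_of_nonneg hh.le, inv_mul_lt_iff₀ hh, mul_one, ← dist_eq_norm]
  exact hs.2

theorem lintegral_normalized_kernel {α β : Type*} [MeasurableSpace α] [MeasurableSpace β]
    {μ : Measure α} {η : Measure β} [SFinite μ] [SFinite η] {c : ℝ≥0∞} (hc : c ≠ ∞)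
    {k : α → β → ℝ≥0∞} (hk : Measurable (Function.uncurry k)) {w : β → ℝ≥0∞}
    (hw : ∀ t, w t = c * ∫⁻ s, k s t ∂μ) (hfin : ∀ t, w t ≠ ∞) :
    ∫⁻ s, c * ∫⁻ t, (w t)⁻¹ * k s t ∂η ∂μ = η {t | w t ≠ 0} := by
  have hwm : Measurable w := by
    rw [funext hw]
    exact hk.lintegral_prod_left'.const_mul c
  have hsupp : MeasurableSet {t | w t ≠ 0} := (hwm (measurableSet_singleton 0)).compl
  have hnormalized (t : β) : c * ∫⁻ s, (w t)⁻¹ * k s t ∂μ = {t | w t ≠ 0}.indicator 1 t := by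
    have hslice : Measurable fun s => k s t := hk.comp measurable_prodMk_right
    rw [lintegral_const_mul _ hslice, mul_left_comm, ← hw]
    by_cases ht : w t = 0
    · simp [ht]
    · rw [ENNReal.inv_mul_cancel ht (hfin t), indicator_of_mem (show t ∈ {t | w t ≠ 0} from ht)]
      rfl
  have hjoint : Measurable (Function.uncurry fun s t => (w t)⁻¹ * k s t) :=
    (hwm.comp measurable_snd).inv.mul hk
  rw [lintegral_const_mul' _ _ hc, lintegral_lintegral_swap hjoint.aemeasurable,
    ← lintegral_const_mul' _ _ hc, lintegral_congr hnormalized, lintegral_indicator_one hsupp]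

theorem lintegral_kernelEstimator (hh : 0 < h) (D : Set (Space d)) (η : Measure (Space d))
    [SFinite η] :
    ∫⁻ s in D, kernelEstimator h D η s = η ({t | edgeWeight h D t ≠ 0} ∩ D) := by
  have hsupp : MeasurableSet {t | edgeWeight h D t ≠ 0} :=
    (measurable_edgeWeight h D (measurableSet_singleton 0)).compl
  rw [← Measure.restrict_apply hsupp]
  exact lintegral_normalized_kernel (by simp [pow_pos hh]) (measurable_epanechnikov_scaled h)
    (fun _ => rfl) fun t => (edgeWeight_lt_top hh D t).ne

end Epanechnikov

variable {d : ℕ}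

section SupRatio

theorem supRatio_eq_of_dense {K Q : Set (Space d)} (hQK : Q ⊆ K) (hKQ : K ⊆ closure Q)
    {y : Space d → ℝ} (hy : ContinuousOn y K) (hpos : ∀ t ∈ K, 0 < y t) :
    supRatio K y = supRatio Q y := by
  ext s x
  refine le_antisymm (iSup₂_le fun t ht => ?_) (biSup_mono fun _ ht => hQK ht)
  have hratio : ContinuousOn (fun t => ENNReal.ofReal (x (t - s) / y t)) K :=
    ENNReal.continuous_ofReal.comp_continuousOn
      ((Continuous.continuousOn (by fun_prop)).div hy fun t ht => (hpos t ht).ne')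
  have : (nhdsWithin t Q).NeBot := mem_closure_iff_nhdsWithin_neBot.1 (hKQ ht)
  rw [← ENNReal.ofReal_div_of_pos (hpos t ht)]
  refine le_of_tendsto ((hratio t ht).mono hQK) ?_
  filter_upwards [self_mem_nhdsWithin] with t' ht'
  rw [ENNReal.ofReal_div_of_pos (hpos t' (hQK ht'))]
  exact le_iSup₂ (f := fun t _ => ENNReal.ofReal (x (t - s)) / ENNReal.ofReal (y t)) t' ht'

theorem measurable_eval_path {α : Type*} [MeasurableSpace α] {x : α → PathSpace d}
    {s : α → Space d} (hx : Measurable x) (hs : Measurable s) : Measurable fun a => x a (s a) := by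
  have heval : Continuous fun z : PathSpace d × Space d => z.1 z.2 := by fun_prop
  exact heval.measurable.comp (hx.prodMk hs)

theorem measurable_supRatio {α : Type*} [MeasurableSpace α] {Q : Set (Space d)}
    (hQ : Q.Countable) {y : α → Space d → ℝ} (hy : ∀ t, Measurable fun a => y a t)
    {s : α → Space d} (hs : Measurable s) {x : α → PathSpace d} (hx : Measurable x) :
    Measurable fun a => supRatio Q (y a) (s a) (x a) :=
  Measurable.biSup Q hQ fun t _ =>
    (measurable_eval_path hx (measurable_const.sub hs)).ennreal_ofReal.div (hy t).ennreal_ofReal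

end SupRatio

section DirectingMeasure

/-- The directing measure as a kernel from the realizations of the spatial intensity. It is built
from a density with values in `ℝ≥0`, so that it is an s-finite kernel by construction; it agrees
with `directingMeasure` when `0 < μY`. -/
noncomputable def directingKernel (μY : ℝ) (PX : Measure (PathSpace d)) [SFinite PX] :
    Kernel (PathSpace d) (Storm d) :=
  Kernel.withDensity (Kernel.const _ ((volume : Measure (Space d)).prod (severityMeasure.prod PX)))
    (fun ψ q => ((μY.toNNReal⁻¹ * (ψ q.1).toNNReal : ℝ≥0) : ℝ≥0∞))

instance (μY : ℝ) (PX : Measure (PathSpace d)) [SFinite PX] :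
    IsSFiniteKernel (directingKernel μY PX) := by
  unfold directingKernel
  infer_instance

variable {μY : ℝ} {PX : Measure (PathSpace d)} {ψ : PathSpace d}

theorem directingKernel_apply (hμY : 0 < μY) (PX : Measure (PathSpace d)) [SFinite PX]
    (ψ : PathSpace d) : directingKernel μY PX ψ = directingMeasure μY PX ψ := by
  have hdensity : Measurable fun z : PathSpace d × Storm d => (z.1 z.2.1).toNNReal :=
    (measurable_eval_path measurable_fst measurable_snd.fst).real_toNNReal
  have hψ : Measurable fun s => ENNReal.ofReal (ψ s) := ψ.continuous.measurable.ennreal_ofReal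
  rw [directingKernel, Kernel.withDensity_apply _ (hdensity.const_mul _).coe_nnreal_ennreal,
    Kernel.const_apply, directingMeasure, prod_withDensity_left hψ, ← withDensity_smul _
    (f := fun z : Storm d => ENNReal.ofReal (ψ z.1)) (hψ.comp measurable_fst)]
  congr 1
  ext q
  rw [ENNReal.coe_mul, ENNReal.coe_inv (by simpa using hμY)]
  rfl

theorem directingMeasure_apply [SFinite PX] {B : Set (Storm d)} (hB : MeasurableSet B) :
    directingMeasure μY PX ψ B = (ENNReal.ofReal μY)⁻¹ *
      ∫⁻ s, ENNReal.ofReal (ψ s) * severityMeasure.prod PX (Prod.mk s ⁻¹' B) := by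
  rw [directingMeasure, Measure.smul_apply, smul_eq_mul, Measure.prod_apply hB,
    lintegral_withDensity_eq_lintegral_mul _ ψ.continuous.measurable.ennreal_ofReal
      (measurable_measure_prodMk_left hB)]
  rfl

theorem directingMeasure_prod [SFinite PX] {D : Set (Space d)} (hD : MeasurableSet D)
    (U : Set ℝ≥0∞) (A : Set (PathSpace d)) :
    directingMeasure μY PX ψ (D ×ˢ U ×ˢ A) = (ENNReal.ofReal μY)⁻¹ *
      ((∫⁻ s in D, ENNReal.ofReal (ψ s)) * (severityMeasure U * PX A)) := by
  rw [directingMeasure, Measure.smul_apply, Measure.prod_prod, Measure.prod_prod,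
    withDensity_apply _ hD, smul_eq_mul]

theorem lintegral_path_lt_top (ψ : PathSpace d) {D : Set (Space d)} (hD : Bornology.IsBounded D) :
    ∫⁻ s in D, ENNReal.ofReal (ψ s) < ∞ :=
  (lintegral_mono_set subset_closure).trans_lt
    (ψ.continuous.continuousOn.integrableOn_compact hD.isCompact_closure).lintegral_lt_top

theorem directingMeasure_prod_lt_top (hμY : 0 < μY) [IsFiniteMeasure PX] {D : Set (Space d)}
    (hD : MeasurableSet D) (hDb : Bornology.IsBounded D) {U : Set ℝ≥0∞}
    (hU : severityMeasure U < ∞) (A : Set (PathSpace d)) :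
    directingMeasure μY PX ψ (D ×ˢ U ×ˢ A) < ∞ := by
  rw [directingMeasure_prod hD]
  exact ENNReal.mul_lt_top (by simp [hμY]) (ENNReal.mul_lt_top (lintegral_path_lt_top ψ hDb)
    (ENNReal.mul_lt_top hU (measure_lt_top PX A)))

/-- The storms with centre in the ball of radius `n` and with severity at least `1 / n`, or zero.
These sets have finite directing measure and exhaust the space of storms; severity zero, which is
a value of the type although no storm has it, is included for the latter. -/
def stormWindow (d n : ℕ) : Set (Storm d) :=
  Metric.closedBall (0 : Space d) n ×ˢ ({u : ℝ≥0∞ | u⁻¹ ≤ n} ∪ {0}) ×ˢ univ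

theorem measurableSet_stormWindow (n : ℕ) : MeasurableSet (stormWindow d n) :=
  Metric.isClosed_closedBall.measurableSet.prod
    (((measurableSet_inv_le n).union (measurableSet_singleton 0)).prod .univ)

theorem iUnion_stormWindow : ⋃ n, stormWindow d n = univ := by
  refine eq_univ_of_forall fun ⟨s, u, x⟩ => ?_
  obtain ⟨n, hn⟩ := exists_nat_ge ‖s‖
  rcases eq_or_ne u 0 with rfl | hu
  · exact mem_iUnion.2 ⟨n, by simpa using hn, Or.inr rfl, mem_univ _⟩
  · obtain ⟨k, hk⟩ := ENNReal.exists_nat_gt (ENNReal.inv_ne_top.2 hu)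
    refine mem_iUnion.2 ⟨max n k, mem_closedBall_zero_iff.2 (hn.trans ?_), Or.inl (hk.le.trans ?_),
      mem_univ _⟩
    · exact_mod_cast le_max_left n k
    · exact_mod_cast le_max_right n k

theorem directingMeasure_stormWindow_lt_top (hμY : 0 < μY) [IsFiniteMeasure PX] (n : ℕ) :
    directingMeasure μY PX ψ (stormWindow d n) < ∞ := by
  refine directingMeasure_prod_lt_top hμY Metric.isClosed_closedBall.measurableSet
    Metric.isBounded_closedBall ((measure_union_le _ _).trans_lt ?_) univ
  rw [severityMeasure_inv_le, severityMeasure_singleton_zero, add_zero]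
  exact ENNReal.natCast_lt_top n

end DirectingMeasure

section Contributing

/-- The storms with centre in `D` that contribute on `K` relative to the threshold `y`. -/
def contributingStorms (D K : Set (Space d)) (y : Space d → ℝ) : Set (Storm d) :=
  {q | q.1 ∈ D ∧ q.2.1⁻¹ ≤ supRatio K y q.1 q.2.2}

variable {D K Q : Set (Space d)}

theorem measurableSet_mem_contributingStorms {α : Type*} [MeasurableSpace α]
    (hD : MeasurableSet D) (hQ : Q.Countable) {y : α → Space d → ℝ}
    (hy : ∀ t, Measurable fun a => y a t) :
    MeasurableSet {z : α × Storm d | z.2 ∈ contributingStorms D Q (y z.1)} :=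
  (measurable_snd.fst hD).inter (measurableSet_le measurable_snd.snd.fst.inv
    (measurable_supRatio hQ (fun t => (hy t).comp measurable_fst) measurable_snd.fst
      measurable_snd.snd.snd))

theorem measurableSet_contributingStorms (hD : MeasurableSet D) (hQ : Q.Countable)
    (y : Space d → ℝ) : MeasurableSet (contributingStorms D Q y) :=
  measurable_prodMk_left (x := ()) (measurableSet_mem_contributingStorms (α := Unit) hD hQ
    (y := fun _ => y) fun _ => measurable_const)

section

variable {Ω : Type*} (p : ℕ → Ω → Storm d) {y : Space d → ℝ}

instance (K : Set (Space d)) (y : Space d → ℝ) (ω : Ω) : SFinite (contributing p K y ω) := by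
  classical
  unfold contributing
  have (i : ℕ) : SFinite (if (p i ω).2.1⁻¹ ≤ supRatio K y (p i ω).1 (p i ω).2.2 then
      Measure.dirac (p i ω).1 else 0) := by
    split_ifs <;> infer_instance
  infer_instance

theorem contributing_apply (hQ : Q.Countable) (y : Space d → ℝ) (ω : Ω) (hD : MeasurableSet D) :
    contributing p Q y ω D = pointProcess p ω (contributingStorms D Q y) := by
  rw [contributing, pointProcess_apply p ω (measurableSet_contributingStorms hD hQ y),
    Measure.sum_apply _ hD]
  refine tsum_congr fun i => ?_
  by_cases hcontr : (p i ω).2.1⁻¹ ≤ supRatio Q y (p i ω).1 (p i ω).2.2 <;>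
    by_cases hmem : (p i ω).1 ∈ D <;> simp [contributingStorms, hcontr, hmem, hD]

theorem contributing_congr (h : supRatio K y = supRatio Q y) :
    contributing p K y = contributing p Q y := by
  unfold contributing
  rw [h]

end

variable {μY : ℝ} {PX : Measure (PathSpace d)} {ψ : PathSpace d} {y : Space d → ℝ}

theorem contributingIntensity_congr (h : supRatio K y = supRatio Q y) :
    contributingIntensity μY PX K y ψ = contributingIntensity μY PX Q y ψ := by
  unfold contributingIntensity correctingFactor
  rw [h]

-- By Fubini, as the severities that make a storm with centre `s` and shape `x` contribute have
-- mass `supRatio Q y s x`.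
theorem directingMeasure_contributingStorms (hμY : 0 < μY) [SFinite PX] (hD : MeasurableSet D)
    (hQ : Q.Countable) (y : Space d → ℝ) :
    directingMeasure μY PX ψ (contributingStorms D Q y)
      = ∫⁻ s in D, contributingIntensity μY PX Q y ψ s := by
  have hmeas := measurableSet_contributingStorms hD hQ y
  have hsection (s : Space d) : severityMeasure.prod PX (Prod.mk s ⁻¹' contributingStorms D Q y)
      = D.indicator (fun s => ∫⁻ x, supRatio Q y s x ∂PX) s := by
    rw [Measure.prod_apply_symm (measurable_prodMk_left hmeas)]
    by_cases hs : s ∈ D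
    · rw [indicator_of_mem hs]
      refine lintegral_congr fun x => ?_
      rw [← severityMeasure_inv_le (supRatio Q y s x)]
      congr 1
      ext u
      simp [contributingStorms, hs]
    · simp [contributingStorms, hs]
  rw [directingMeasure_apply hmeas, ← lintegral_const_mul' _ _ (by simp [hμY]),
    ← lintegral_indicator hD]
  refine lintegral_congr fun s => ?_
  rw [hsection]
  by_cases hs : s ∈ D
  · simp only [indicator_of_mem hs, contributingIntensity, correctingFactor]
    ring
  · simp [indicator_of_notMem hs]

theorem measurable_lintegral_contributingIntensity {α : Type*} [MeasurableSpace α] [SFinite PX]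
    (hQ : Q.Countable) {y : α → Space d → ℝ} (hy : ∀ t, Measurable fun a => y a t)
    {ψ : α → PathSpace d} (hψ : Measurable ψ) (D : Set (Space d)) :
    Measurable fun a => ∫⁻ s in D, contributingIntensity μY PX Q (y a) (ψ a) s := by
  have hcorrecting :
      Measurable fun z : α × Space d => correctingFactor μY PX Q (y z.1) z.2 :=
    (Measurable.lintegral_prod_right' (ν := PX)
      (f := fun z : (α × Space d) × PathSpace d => supRatio Q (y z.1.1) z.1.2 z.2)
      (measurable_supRatio hQ (fun t => (hy t).comp measurable_fst.fst) measurable_fst.snd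
        measurable_snd)).const_mul _
  exact Measurable.lintegral_prod_right' (ν := volume.restrict D) (hcorrecting.mul
    (measurable_eval_path (hψ.comp measurable_fst) measurable_snd).ennreal_ofReal)

theorem correctingFactor_le {C c : ℝ} (hX : ∀ᵐ x ∂PX, ∀ t, x t ≤ C) (hy : ∀ t ∈ K, c ≤ y t)
    (s : Space d) :
    correctingFactor μY PX K y s
      ≤ (ENNReal.ofReal μY)⁻¹ * (ENNReal.ofReal C / ENNReal.ofReal c * PX univ) := by
  rw [correctingFactor, ← lintegral_const]
  refine mul_le_mul_right ?_ _
  refine lintegral_mono_ae (hX.mono fun x hx => iSup₂_le fun t ht => ?_)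
  exact ENNReal.div_le_div (ENNReal.ofReal_le_ofReal (hx _)) (ENNReal.ofReal_le_ofReal (hy t ht))

theorem lintegral_contributingIntensity_lt_top (hμY : 0 < μY) [IsFiniteMeasure PX] {C : ℝ}
    (hX : ∀ᵐ x ∂PX, ∀ t, x t ≤ C) (hK : IsCompact K) (hD : Bornology.IsBounded D)
    (hy : ContinuousOn y K) (hpos : ∀ t ∈ K, 0 < y t) (ψ : PathSpace d) :
    ∫⁻ s in D, contributingIntensity μY PX K y ψ s < ∞ := by
  obtain ⟨c, hc, hcy⟩ : ∃ c : ℝ, 0 < c ∧ ∀ t ∈ K, c ≤ y t := hK.exists_forall_le' hy hpos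
  set b := (ENNReal.ofReal μY)⁻¹ * (ENNReal.ofReal C / ENNReal.ofReal c * PX univ)
  have hb : b < ∞ := ENNReal.mul_lt_top (by simp [hμY]) (ENNReal.mul_lt_top
    (ENNReal.div_lt_top ENNReal.ofReal_ne_top (by simpa using hc)) (measure_lt_top PX univ))
  calc ∫⁻ s in D, contributingIntensity μY PX K y ψ s
      ≤ ∫⁻ s in D, b * ENNReal.ofReal (ψ s) :=
        lintegral_mono fun s => mul_le_mul_left (correctingFactor_le hX hcy s) _
    _ = b * ∫⁻ s in D, ENNReal.ofReal (ψ s) := lintegral_const_mul' _ _ hb.ne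
    _ < ∞ := ENNReal.mul_lt_top hb (lintegral_path_lt_top ψ hD)

end Contributing

section Unbiasedness

variable {d : ℕ} {Ω Z : Type*} {m : MeasurableSpace Ω} [MeasurableSpace Ω] [MeasurableSpace Z]
  {P : Measure Ω} {PX : Measure (PathSpace d)} {μY : ℝ} {p : ℕ → Ω → Storm d} {V : Ω → Z}
  {g : Z → PathSpace d}
  {K Q D : Set (Space d)} {y : Z → Space d → ℝ} {h : ℝ} {s : Set Ω}

theorem IsCoxProcess.setLIntegral_kernelEstimator_of_countable [IsFiniteMeasure P]
    [IsFiniteMeasure PX]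
    (hN : IsCoxProcess (MeasurableSpace.comap V inferInstance) (pointProcess p)
      (fun ω => directingMeasure μY PX (g (V ω))) P)
    (hμY : 0 < μY) (hV : Measurable V) (hg : Measurable g) (hp : ∀ i, Measurable (p i))
    (hQ : Q.Countable) (hy : ∀ t, Measurable fun z => y z t) (hD : MeasurableSet D) (hh : 0 < h)
    (hs : MeasurableSet[MeasurableSpace.comap V inferInstance] s) :
    ∫⁻ ω in s, (∫⁻ t in D, kernelEstimator h D (contributing p Q (y (V ω)) ω) t) ∂P
      = ∫⁻ ω in s, (∫⁻ t in D, contributingIntensity μY PX Q (y (V ω)) (g (V ω)) t) ∂P := by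
  set D' : Set (Space d) := {t | edgeWeight h D t ≠ 0} ∩ D
  have hD' : MeasurableSet D' :=
    (measurable_edgeWeight h D (measurableSet_singleton 0)).compl.inter hD
  have hD'_ae : D' =ᵐ[volume] D := by
    refine (LE.le.eventuallyLE inter_subset_right).antisymm (ae_le_set.2 ?_)
    refine measure_mono_null (fun t ht => ?_) (volume_edgeWeight_eq_zero hh hD)
    exact ⟨not_not.1 fun h0 => ht.2 ⟨h0, ht.1⟩, ht.1⟩
  let κ : Kernel Z (Storm d) := (directingKernel μY PX).comap g hg
  have hκ (z : Z) : κ z = directingMeasure μY PX (g z) := directingKernel_apply hμY PX (g z)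
  simp_rw [← hκ] at hN
  calc ∫⁻ ω in s, (∫⁻ t in D, kernelEstimator h D (contributing p Q (y (V ω)) ω) t) ∂P
      = ∫⁻ ω in s, pointProcess p ω (contributingStorms D' Q (y (V ω))) ∂P :=
        lintegral_congr fun ω => by
          rw [lintegral_kernelEstimator hh, contributing_apply p hQ _ ω hD']
    _ = ∫⁻ ω in s, κ (V ω) (contributingStorms D' Q (y (V ω))) ∂P :=
        hN.setLIntegral_pointProcess_preimage hV hp measurableSet_stormWindow
          (fun n z => hκ z ▸ directingMeasure_stormWindow_lt_top hμY n) iUnion_stormWindow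
          (measurableSet_mem_contributingStorms hD' hQ hy) hs
    _ = ∫⁻ ω in s, (∫⁻ t in D, contributingIntensity μY PX Q (y (V ω)) (g (V ω)) t) ∂P :=
        lintegral_congr fun ω => by
          rw [hκ, directingMeasure_contributingStorms hμY hD' hQ, setLIntegral_congr hD'_ae]

theorem exists_countable_supRatio_eq (K : Set (Space d)) :
    ∃ Q : Set (Space d), Q.Countable ∧ ∀ y : Space d → ℝ, ContinuousOn y K → (∀ t ∈ K, 0 < y t) →
      supRatio K y = supRatio Q y := by
  obtain ⟨Q, hQK, hQ, hKQ⟩ :=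
    (TopologicalSpace.IsSeparable.of_separableSpace K).exists_countable_dense_subset
  exact ⟨Q, hQ, fun y => supRatio_eq_of_dense hQK hKQ⟩

theorem IsCoxProcess.setLIntegral_kernelEstimator [IsFiniteMeasure P] [IsFiniteMeasure PX]
    (hN : IsCoxProcess (MeasurableSpace.comap V inferInstance) (pointProcess p)
      (fun ω => directingMeasure μY PX (g (V ω))) P)
    (hμY : 0 < μY) (hV : Measurable V) (hg : Measurable g) (hp : ∀ i, Measurable (p i))
    (hy : ∀ t, Measurable fun z => y z t)
    (hyK : ∀ᵐ ω ∂P, ContinuousOn (y (V ω)) K ∧ ∀ t ∈ K, 0 < y (V ω) t)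
    (hD : MeasurableSet D) (hh : 0 < h)
    (hs : MeasurableSet[MeasurableSpace.comap V inferInstance] s) :
    ∫⁻ ω in s, (∫⁻ t in D, kernelEstimator h D (contributing p K (y (V ω)) ω) t) ∂P
      = ∫⁻ ω in s, (∫⁻ t in D, contributingIntensity μY PX K (y (V ω)) (g (V ω)) t) ∂P := by
  obtain ⟨Q, hQ, hsup⟩ := exists_countable_supRatio_eq K
  have hyQ : ∀ᵐ ω ∂P.restrict s, supRatio K (y (V ω)) = supRatio Q (y (V ω)) :=
    ae_restrict_of_ae (hyK.mono fun ω hω => hsup _ hω.1 hω.2)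
  calc ∫⁻ ω in s, (∫⁻ t in D, kernelEstimator h D (contributing p K (y (V ω)) ω) t) ∂P
      = ∫⁻ ω in s, (∫⁻ t in D, kernelEstimator h D (contributing p Q (y (V ω)) ω) t) ∂P :=
        lintegral_congr_ae (hyQ.mono fun ω hω => by simp only [contributing_congr p hω])
    _ = ∫⁻ ω in s, (∫⁻ t in D, contributingIntensity μY PX Q (y (V ω)) (g (V ω)) t) ∂P :=
        hN.setLIntegral_kernelEstimator_of_countable hμY hV hg hp hQ hy hD hh hs
    _ = ∫⁻ ω in s, (∫⁻ t in D, contributingIntensity μY PX K (y (V ω)) (g (V ω)) t) ∂P :=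
        lintegral_congr_ae (hyQ.mono fun ω hω => by simp only [contributingIntensity_congr hω])

theorem IsCoxProcess.lintegral_kernelEstimator [IsFiniteMeasure P] [IsFiniteMeasure PX]
    (hN : IsCoxProcess (MeasurableSpace.comap V inferInstance) (pointProcess p)
      (fun ω => directingMeasure μY PX (g (V ω))) P)
    (hμY : 0 < μY) (hV : Measurable V) (hg : Measurable g) (hp : ∀ i, Measurable (p i))
    (hy : ∀ t, Measurable fun z => y z t)
    (hyK : ∀ᵐ ω ∂P, ContinuousOn (y (V ω)) K ∧ ∀ t ∈ K, 0 < y (V ω) t)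
    (hD : MeasurableSet D) (hh : 0 < h) :
    ∫⁻ ω, (∫⁻ t in D, kernelEstimator h D (contributing p K (y (V ω)) ω) t) ∂P
      = ∫⁻ ω, (∫⁻ t in D, contributingIntensity μY PX K (y (V ω)) (g (V ω)) t) ∂P := by
  simpa only [setLIntegral_univ] using
    hN.setLIntegral_kernelEstimator hμY hV hg hp hy hyK hD hh MeasurableSet.univ

theorem IsCoxProcess.condLExp_kernelEstimator_of_le [IsFiniteMeasure P] [IsFiniteMeasure PX]
    (hN : IsCoxProcess (MeasurableSpace.comap V inferInstance) (pointProcess p)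
      (fun ω => directingMeasure μY PX (g (V ω))) P)
    (hμY : 0 < μY) (hV : Measurable V) (hg : Measurable g) (hp : ∀ i, Measurable (p i))
    (hy : ∀ t, Measurable fun z => y z t)
    (hyK : ∀ᵐ ω ∂P, ContinuousOn (y (V ω)) K ∧ ∀ t ∈ K, 0 < y (V ω) t)
    (hD : MeasurableSet D) (hh : 0 < h)
    (hm : m ≤ MeasurableSpace.comap V inferInstance) :
    P⁻[fun ω => ∫⁻ t in D, kernelEstimator h D (contributing p K (y (V ω)) ω) t | m]
      =ᵐ[P] P⁻[fun ω => ∫⁻ t in D, contributingIntensity μY PX K (y (V ω)) (g (V ω)) t | m] :=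
  condLExp_congr_of_setLIntegral_eq (hm.trans hV.comap_le) fun s hs =>
    hN.setLIntegral_kernelEstimator hμY hV hg hp hy hyK hD hh (hm s hs)

theorem condLExp_comap_contributingIntensity [IsFiniteMeasure P] [SFinite PX]
    (hV : Measurable V) (hg : Measurable g) (hy : ∀ t, Measurable fun z => y z t)
    (hyK : ∀ᵐ ω ∂P, ContinuousOn (y (V ω)) K ∧ ∀ t ∈ K, 0 < y (V ω) t) (D : Set (Space d)) :
    P⁻[fun ω => ∫⁻ t in D, contributingIntensity μY PX K (y (V ω)) (g (V ω)) t |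
        MeasurableSpace.comap V inferInstance]
      =ᵐ[P] fun ω => ∫⁻ t in D, contributingIntensity μY PX K (y (V ω)) (g (V ω)) t := by
  obtain ⟨Q, hQ, hsup⟩ := exists_countable_supRatio_eq K
  have hKQ : (fun ω => ∫⁻ t in D, contributingIntensity μY PX K (y (V ω)) (g (V ω)) t)
      =ᵐ[P] fun ω => ∫⁻ t in D, contributingIntensity μY PX Q (y (V ω)) (g (V ω)) t :=
    hyK.mono fun ω hω => by simp only [contributingIntensity_congr (hsup _ hω.1 hω.2)]
  have hmeas := (measurable_lintegral_contributingIntensity (μY := μY) (PX := PX) hQ hy hg D).comp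
    (comap_measurable V)
  exact (condLExp_congr_ae hKQ).trans
    ((condLExp_eq_self hV.comap_le P hmeas).eventuallyEq.trans hKQ.symm)

theorem IsCoxProcess.condLExp_kernelEstimator [IsFiniteMeasure P] [IsFiniteMeasure PX]
    (hN : IsCoxProcess (MeasurableSpace.comap V inferInstance) (pointProcess p)
      (fun ω => directingMeasure μY PX (g (V ω))) P)
    (hμY : 0 < μY) (hV : Measurable V) (hg : Measurable g) (hp : ∀ i, Measurable (p i))
    (hy : ∀ t, Measurable fun z => y z t)
    (hyK : ∀ᵐ ω ∂P, ContinuousOn (y (V ω)) K ∧ ∀ t ∈ K, 0 < y (V ω) t)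
    (hD : MeasurableSet D) (hh : 0 < h) :
    P⁻[fun ω => ∫⁻ t in D, kernelEstimator h D (contributing p K (y (V ω)) ω) t |
        MeasurableSpace.comap V inferInstance]
      =ᵐ[P] fun ω => ∫⁻ t in D, contributingIntensity μY PX K (y (V ω)) (g (V ω)) t :=
  (hN.condLExp_kernelEstimator_of_le hμY hV hg hp hy hyK hD hh le_rfl).trans
    (condLExp_comap_contributingIntensity hV hg hy hyK D)

end Unbiasedness

section Positivity

variable {d : ℕ} {Ω : Type*} {p : ℕ → Ω → Storm d} {r : ℝ}

theorem measurableSet_pos_on_closedBall (d : ℕ) (r : ℝ) :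
    MeasurableSet {x : PathSpace d | ∀ t ∈ Metric.closedBall (0 : Space d) r, 0 < x t} :=
  (ContinuousMap.isOpen_setOfPred_mapsTo (isCompact_closedBall _ _) isOpen_Ioi).measurableSet

theorem exists_inv_natCast_le_extremalProcess {ω : Ω} {i : ℕ} (c : Space d)
    (hc : (p i ω).1 ∈ Metric.closedBall c (r / 2)) (hu : (p i ω).2.1 ≠ 0)
    (hpos : ∀ t ∈ Metric.closedBall (0 : Space d) r, 0 < (p i ω).2.2 t) :
    ∃ n : ℕ, ∀ t ∈ Metric.closedBall c (r / 2), (n : ℝ≥0∞)⁻¹ ≤ extremalProcess p ω t := by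
  obtain ⟨a, ha, hax⟩ := (isCompact_closedBall (0 : Space d) r).exists_forall_le'
    (p i ω).2.2.continuous.continuousOn hpos
  obtain ⟨n, hn⟩ := ENNReal.exists_inv_nat_lt
    (mul_ne_zero hu (ENNReal.ofReal_pos.2 ha).ne')
  refine ⟨n, fun t ht => hn.le.trans (le_iSup_of_le i (mul_le_mul_right ?_ _))⟩
  refine ENNReal.ofReal_le_ofReal (hax _ ?_)
  rw [mem_closedBall_zero_iff, ← dist_eq_norm]
  calc dist t (p i ω).1 ≤ dist t c + dist (p i ω).1 c := dist_triangle_right _ _ _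
    _ ≤ r / 2 + r / 2 := add_le_add ht hc
    _ = r := add_halves r

variable [MeasurableSpace Ω] {P : Measure Ω} {PX : Measure (PathSpace d)} {μY : ℝ}
  {Ψ : Ω → PathSpace d}

-- The storms with centre in `D`, severity at least `1 / n` and shape in `A` have directing measure
-- proportional to `n`.
theorem IsCoxProcess.ae_exists_storm_mem [IsFiniteMeasure P] [IsFiniteMeasure PX]
    (hN : IsCoxProcess (MeasurableSpace.comap Ψ inferInstance) (pointProcess p)
      (fun ω => directingMeasure μY PX (Ψ ω)) P)
    (hμY : 0 < μY) (hΨ : Measurable Ψ) (hΨ_pos : ∀ᵐ ω ∂P, ∀ s, 0 < Ψ ω s)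
    (hp : ∀ i, Measurable (p i)) {D : Set (Space d)} (hD : MeasurableSet D)
    (hDb : Bornology.IsBounded D) (hD0 : volume D ≠ 0) {A : Set (PathSpace d)}
    (hA : MeasurableSet A) (hA0 : PX A ≠ 0) :
    ∀ᵐ ω ∂P, ∃ i, p i ω ∈ D ×ˢ ({0}ᶜ : Set ℝ≥0∞) ×ˢ A := by
  have hsub (n : ℕ) : D ×ˢ {u : ℝ≥0∞ | u⁻¹ ≤ n} ×ˢ A ⊆ D ×ˢ ({0}ᶜ : Set ℝ≥0∞) ×ˢ A := by
    refine prod_mono_right (prod_mono_left fun u hu h0 => ?_)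
    simp [mem_singleton_iff.1 h0] at hu
  refine (hN.ae_ne_zero_of_tendsto_top hΨ.comap_le (measurable_pointProcess hp)
    (fun n => hD.prod ((measurableSet_inv_le n).prod hA)) hsub
    (fun n => Filter.Eventually.of_forall fun ω => ?_) ?_).mono fun ω =>
      exists_mem_of_pointProcess_ne_zero (hD.prod ((measurableSet_singleton 0).compl.prod hA))
  · refine directingMeasure_prod_lt_top hμY hD hDb ?_ A
    exact (severityMeasure_inv_le n).trans_lt (ENNReal.natCast_lt_top n)
  filter_upwards [hΨ_pos] with ω hω
  have hΨD : ∫⁻ s in D, ENNReal.ofReal (Ψ ω s) ≠ 0 := by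
    refine ((setLIntegral_pos_iff (Ψ ω).continuous.measurable.ennreal_ofReal).2 ?_).ne'
    have hsupp : Function.support (fun s => ENNReal.ofReal (Ψ ω s)) = univ :=
      eq_univ_of_forall fun s => by simpa using hω s
    rwa [hsupp, univ_inter, pos_iff_ne_zero]
  have hmass (n : ℕ) : directingMeasure μY PX (Ψ ω) (D ×ˢ {u : ℝ≥0∞ | u⁻¹ ≤ n} ×ˢ A)
      = n * ((ENNReal.ofReal μY)⁻¹ * ((∫⁻ s in D, ENNReal.ofReal (Ψ ω s)) * PX A)) := by
    rw [directingMeasure_prod hD, severityMeasure_inv_le]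
    ring
  have hne : (ENNReal.ofReal μY)⁻¹ * ((∫⁻ s in D, ENNReal.ofReal (Ψ ω s)) * PX A) ≠ 0 :=
    mul_ne_zero (by simp) (mul_ne_zero hΨD hA0)
  simp_rw [hmass]
  rw [← ENNReal.top_mul hne]
  exact ENNReal.Tendsto.mul_const ENNReal.tendsto_nat_nhds_top (Or.inl ENNReal.top_ne_zero)

theorem IsCoxProcess.ae_exists_inv_natCast_le_extremalProcess [IsFiniteMeasure P]
    [IsFiniteMeasure PX]
    (hN : IsCoxProcess (MeasurableSpace.comap Ψ inferInstance) (pointProcess p)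
      (fun ω => directingMeasure μY PX (Ψ ω)) P)
    (hμY : 0 < μY) (hΨ : Measurable Ψ) (hΨ_pos : ∀ᵐ ω ∂P, ∀ s, 0 < Ψ ω s)
    (hp : ∀ i, Measurable (p i)) (hr : 0 < r)
    (hPX : PX {x | ∀ t ∈ Metric.closedBall (0 : Space d) r, 0 < x t} ≠ 0) (c : Space d) :
    ∀ᵐ ω ∂P, ∃ n : ℕ, ∀ t ∈ Metric.closedBall c (r / 2),
      (n : ℝ≥0∞)⁻¹ ≤ extremalProcess p ω t := by
  filter_upwards [hN.ae_exists_storm_mem hμY hΨ hΨ_pos hp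
    Metric.isClosed_closedBall.measurableSet Metric.isBounded_closedBall
    (Metric.measure_closedBall_pos volume c (half_pos hr)).ne'
    (measurableSet_pos_on_closedBall d r) hPX] with ω ⟨i, hc, hu, hpos⟩
  exact exists_inv_natCast_le_extremalProcess c hc hu hpos

theorem ae_forall_mem_pos_of_identDistrib {E : Type*} [PseudoMetricSpace E]
    [TopologicalSpace.SeparableSpace E] {Y : Ω → E → ℝ≥0∞} {W : Ω → C(E, ℝ)}
    (hWY : IdentDistrib (fun ω t => ENNReal.ofReal (W ω t)) Y P P) {A : Set E}
    (hY : ∀ᵐ ω ∂P, ∃ n : ℕ, ∀ t ∈ A, (n : ℝ≥0∞)⁻¹ ≤ Y ω t) : ∀ᵐ ω ∂P, ∀ t ∈ A, 0 < W ω t := by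
  obtain ⟨Q, hQA, hQ, hAQ⟩ :=
    (TopologicalSpace.IsSeparable.of_separableSpace A).exists_countable_dense_subset
  have hmeas : MeasurableSet {f : E → ℝ≥0∞ | ∃ n : ℕ, ∀ t ∈ Q, (n : ℝ≥0∞)⁻¹ ≤ f t} := by
    simp_rw [ofPred_exists, ofPred_forall]
    exact .iUnion fun n => .biInter hQ fun t _ =>
      measurableSet_le measurable_const (measurable_pi_apply t)
  filter_upwards [hWY.symm.ae_snd hmeas
    (hY.mono fun ω ⟨n, hn⟩ => ⟨n, fun t ht => hn t (hQA ht)⟩)] with ω ⟨n, hn⟩ t ht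
  have hclosed : IsClosed {t | (n : ℝ≥0∞)⁻¹ ≤ ENNReal.ofReal (W ω t)} :=
    isClosed_le continuous_const (ENNReal.continuous_ofReal.comp (W ω).continuous)
  have hle : (n : ℝ≥0∞)⁻¹ ≤ ENNReal.ofReal (W ω t) := closure_minimal hn hclosed (hAQ ht)
  exact ENNReal.ofReal_pos.1 ((ENNReal.inv_pos.2 (ENNReal.natCast_ne_top n)).trans_le hle)

theorem ae_forall_of_ae_forall_mem_closedBall {E : Type*} [PseudoMetricSpace E]
    [TopologicalSpace.SeparableSpace E] {q : Ω → E → Prop} {ρ : ℝ} (hρ : 0 < ρ)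
    (hq : ∀ c, ∀ᵐ ω ∂P, ∀ t ∈ Metric.closedBall c ρ, q ω t) : ∀ᵐ ω ∂P, ∀ t, q ω t := by
  obtain ⟨S, hS, hS_dense⟩ := TopologicalSpace.exists_countable_dense E
  filter_upwards [(ae_ball_iff hS).2 fun c _ => hq c] with ω hω t
  obtain ⟨c, hc, hct⟩ := hS_dense.exists_dist_lt t hρ
  exact hω c hc t (Metric.mem_closedBall.2 hct.le)

theorem IsCoxProcess.ae_forall_pos_of_identDistrib_extremalProcess [IsFiniteMeasure P]
    [IsFiniteMeasure PX]
    (hN : IsCoxProcess (MeasurableSpace.comap Ψ inferInstance) (pointProcess p)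
      (fun ω => directingMeasure μY PX (Ψ ω)) P)
    (hμY : 0 < μY) (hΨ : Measurable Ψ) (hΨ_pos : ∀ᵐ ω ∂P, ∀ s, 0 < Ψ ω s)
    (hp : ∀ i, Measurable (p i)) (hr : 0 < r)
    (hPX : PX {x | ∀ t ∈ Metric.closedBall (0 : Space d) r, 0 < x t} ≠ 0) {W : Ω → PathSpace d}
    (hW : IdentDistrib (fun ω t => ENNReal.ofReal (W ω t)) (extremalProcess p) P P) :
    ∀ᵐ ω ∂P, ∀ t, 0 < W ω t :=
  ae_forall_of_ae_forall_mem_closedBall (half_pos hr) fun c =>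
    ae_forall_mem_pos_of_identDistrib hW
      (hN.ae_exists_inv_natCast_le_extremalProcess hμY hΨ hΨ_pos hp hr hPX c)

end Positivity

end CoxExtremal

open CoxExtremal in
theorem mainTheorem9_general {d : ℕ} {Ω : Type*} [MeasurableSpace Ω]
    {P : Measure Ω} [IsProbabilityMeasure P]
    (PX : Measure (PathSpace d)) [IsProbabilityMeasure PX]
    (hX_nonneg : ∀ᵐ x ∂PX, ∀ t, 0 ≤ x t) {C : ℝ} (hX_le : ∀ᵐ x ∂PX, ∀ t, x t ≤ C)
    {μY : ℝ} (hμY : 0 < μY)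
    {Ψ : Ω → PathSpace d} (hΨ : Measurable Ψ) (hΨ_nonneg : ∀ᵐ ω ∂P, ∀ s, 0 ≤ Ψ ω s)
    {p : ℕ → Ω → Storm d} (hp : ∀ i, Measurable (p i))
    (hN : IsCoxProcess (MeasurableSpace.comap Ψ inferInstance) (pointProcess p)
      (fun ω => directingMeasure μY PX (Ψ ω)) P)
    {K : Set (Space d)} (hK : IsCompact K)
    {Ystar : Ω → PathSpace d} (hYstar : Measurable Ystar)
    (hYstar_pos : ∀ᵐ ω ∂P, ∀ t ∈ K, 0 < Ystar ω t)
    (hindep : CondIndependent (MeasurableSpace.comap Ψ inferInstance)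
      (MeasurableSpace.comap Ystar inferInstance)
      (MeasurableSpace.comap (pointProcess p) inferInstance) P)
    {D : Set (Space d)} (hD : MeasurableSet D) (hDb : Bornology.IsBounded D)
    {h : ℝ} (hh : 0 < h) :
    (∀ y : Space d → ℝ, ContinuousOn y K → (∀ t ∈ K, 0 < y t) →
      (∀ᵐ ω ∂P, (∫⁻ s in D, contributingIntensity μY PX K y (Ψ ω) s) < ∞) ∧
      P⁻[fun ω => ∫⁻ s in D, kernelEstimator h D (contributing p K y ω) s |
          MeasurableSpace.comap Ψ inferInstance]
        =ᵐ[P] (fun ω => ∫⁻ s in D, contributingIntensity μY PX K y (Ψ ω) s) ∧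
      ∫⁻ ω, (∫⁻ s in D, kernelEstimator h D (contributing p K y ω) s) ∂P
        = ∫⁻ ω, (∫⁻ s in D, contributingIntensity μY PX K y (Ψ ω) s) ∂P) ∧
    (∀ᵐ ω ∂P, (∫⁻ s in D, contributingIntensity μY PX K (Ystar ω) (Ψ ω) s) < ∞) ∧
    P⁻[fun ω => ∫⁻ s in D, kernelEstimator h D (contributing p K (Ystar ω) ω) s |
        MeasurableSpace.comap (fun ω => (Ψ ω, Ystar ω)) inferInstance]
      =ᵐ[P] (fun ω => ∫⁻ s in D, contributingIntensity μY PX K (Ystar ω) (Ψ ω) s) ∧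
    P⁻[fun ω => ∫⁻ s in D, kernelEstimator h D (contributing p K (Ystar ω) ω) s |
        MeasurableSpace.comap Ystar inferInstance]
      =ᵐ[P] P⁻[fun ω => ∫⁻ s in D, contributingIntensity μY PX K (Ystar ω) (Ψ ω) s |
        MeasurableSpace.comap Ystar inferInstance] ∧
    ∫⁻ ω, (∫⁻ s in D, kernelEstimator h D (contributing p K (Ystar ω) ω) s) ∂P
      = ∫⁻ ω, (∫⁻ s in D, contributingIntensity μY PX K (Ystar ω) (Ψ ω) s) ∂P := by
  have hfin {y : Space d → ℝ} (hy : ContinuousOn y K) (hpos : ∀ t ∈ K, 0 < y t)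
      (ψ : PathSpace d) : ∫⁻ s in D, contributingIntensity μY PX K y ψ s < ∞ :=
    lintegral_contributingIntensity_lt_top hμY hX_le hK hDb hy hpos ψ
  refine ⟨fun y hy hpos => ?_, ?_⟩
  · have hyK : ∀ᵐ _ ∂P, ContinuousOn y K ∧ ∀ t ∈ K, 0 < y t := ae_of_all _ fun _ => ⟨hy, hpos⟩
    exact ⟨ae_of_all _ fun ω => hfin hy hpos (Ψ ω),
      hN.condLExp_kernelEstimator hμY hΨ measurable_id hp (g := id) (y := fun _ => y)
        (fun _ => measurable_const) hyK hD hh,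
      hN.lintegral_kernelEstimator hμY hΨ measurable_id hp (g := id) (y := fun _ => y)
        (fun _ => measurable_const) hyK hD hh⟩
  · have hV : Measurable fun ω => (Ψ ω, Ystar ω) := hΨ.prodMk hYstar
    have hNV := hN.comap_prodMk hΨ hYstar (measurable_pointProcess hp) hindep
    have hy (t : Space d) : Measurable fun z : PathSpace d × PathSpace d => z.2 t :=
      measurable_eval_path measurable_snd measurable_const
    have hyK : ∀ᵐ ω ∂P, ContinuousOn (Ystar ω) K ∧ ∀ t ∈ K, 0 < Ystar ω t :=
      hYstar_pos.mono fun ω hω => ⟨(Ystar ω).continuous.continuousOn, hω⟩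
    have hle : MeasurableSpace.comap Ystar inferInstance
        ≤ MeasurableSpace.comap (fun ω => (Ψ ω, Ystar ω)) inferInstance :=
      (measurable_snd.comp (comap_measurable fun ω => (Ψ ω, Ystar ω))).comap_le
    exact ⟨hyK.mono fun ω hω => hfin hω.1 hω.2 (Ψ ω),
      hNV.condLExp_kernelEstimator hμY hV measurable_fst hp
        (V := fun ω => (Ψ ω, Ystar ω)) (g := Prod.fst) (y := fun z => z.2) hy hyK hD hh,
      hNV.condLExp_kernelEstimator_of_le hμY hV measurable_fst hp
        (V := fun ω => (Ψ ω, Ystar ω)) (g := Prod.fst) (y := fun z => z.2) hy hyK hD hh hle,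
      hNV.lintegral_kernelEstimator hμY hV measurable_fst hp
        (V := fun ω => (Ψ ω, Ystar ω)) (g := Prod.fst) (y := fun z => z.2) hy hyK hD hh⟩

open CoxExtremal in
theorem mainTheorem9
    {Ω : Type*} [MeasurableSpace Ω] (P : Measure Ω) [IsProbabilityMeasure P] (d : ℕ)
    -- the law of the storm process, its conditions, and the scaling constant
    (PX : Measure (PathSpace d)) [IsProbabilityMeasure PX]
    (C R : ℝ) (hC : 0 < C) (hR : 0 < R)
    (hX_nonneg : ∀ᵐ x ∂PX, ∀ t, 0 ≤ x t)
    (hX_bounded : ∀ᵐ x ∂PX, ∀ t,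
      x t ≤ (Metric.closedBall (0 : Space d) R).indicator (fun _ => C) t)
    (hX_supp : ∃ r : ℝ, 0 < r ∧ 0 < PX {x | ∀ t ∈ Metric.closedBall (0 : Space d) r, 0 < x t})
    (μY : ℝ) (hμY : 0 < μY)
    -- the spatial intensity process
    (Ψ : Ω → PathSpace d) (hΨ : Measurable Ψ) (hΨ_pos : ∀ᵐ ω ∂P, ∀ s, 0 < Ψ ω s)
    -- the Cox process of storms `(s_i, u_i, X_i)`
    (p : ℕ → Ω → Storm d) (hp : ∀ i, Measurable (p i))
    (hN : IsCoxProcess (MeasurableSpace.comap Ψ inferInstance) (pointProcess p)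
      (fun ω => directingMeasure μY PX (Ψ ω)) P)
    -- conditionally on `Ψ`, the process `Ystar` is a copy of the Cox extremal process
    -- which is independent of the Cox process of storms
    (Ystar : Ω → PathSpace d) (hYstar : Measurable Ystar)
    (hcopy : IdentDistrib (fun ω => (Ψ ω, fun t => ENNReal.ofReal (Ystar ω t)))
      (fun ω => (Ψ ω, extremalProcess p ω)) P P)
    (hindep : CondIndependent (MeasurableSpace.comap Ψ inferInstance)
      (MeasurableSpace.comap Ystar inferInstance)
      (MeasurableSpace.comap (pointProcess p) inferInstance) P)
    -- the compact set `K`, the domain `D ⊆ K_R`, and the bandwidth `h`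
    (K : Set (Space d)) (hK : IsCompact K)
    (D : Set (Space d)) (hD : MeasurableSet D) (hDK : D ⊆ K + Metric.closedBall (0 : Space d) R)
    (h : ℝ) (hh : 0 < h) :
    -- a fixed threshold `y`, conditionally on `Ψ` and in mean
    (∀ y : Space d → ℝ, ContinuousOn y K → (∀ t ∈ K, 0 < y t) →
      (∀ᵐ ω ∂P, (∫⁻ s in D, contributingIntensity μY PX K y (Ψ ω) s) < ∞) ∧
      P⁻[fun ω => ∫⁻ s in D, kernelEstimator h D (contributing p K y ω) s |
          MeasurableSpace.comap Ψ inferInstance]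
        =ᵐ[P] (fun ω => ∫⁻ s in D, contributingIntensity μY PX K y (Ψ ω) s) ∧
      ∫⁻ ω, (∫⁻ s in D, kernelEstimator h D (contributing p K y ω) s) ∂P
        = ∫⁻ ω, (∫⁻ s in D, contributingIntensity μY PX K y (Ψ ω) s) ∂P) ∧
    -- the threshold `Ystar`, conditionally on `(Ψ, Ystar)`, conditionally on `Ystar`, and in mean
    (∀ᵐ ω ∂P, (∫⁻ s in D, contributingIntensity μY PX K (Ystar ω) (Ψ ω) s) < ∞) ∧
    P⁻[fun ω => ∫⁻ s in D, kernelEstimator h D (contributing p K (Ystar ω) ω) s |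
        MeasurableSpace.comap (fun ω => (Ψ ω, Ystar ω)) inferInstance]
      =ᵐ[P] (fun ω => ∫⁻ s in D, contributingIntensity μY PX K (Ystar ω) (Ψ ω) s) ∧
    P⁻[fun ω => ∫⁻ s in D, kernelEstimator h D (contributing p K (Ystar ω) ω) s |
        MeasurableSpace.comap Ystar inferInstance]
      =ᵐ[P] P⁻[fun ω => ∫⁻ s in D, contributingIntensity μY PX K (Ystar ω) (Ψ ω) s |
        MeasurableSpace.comap Ystar inferInstance] ∧
    ∫⁻ ω, (∫⁻ s in D, kernelEstimator h D (contributing p K (Ystar ω) ω) s) ∂P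
      = ∫⁻ ω, (∫⁻ s in D, contributingIntensity μY PX K (Ystar ω) (Ψ ω) s) ∂P := by
  obtain ⟨r, hr, hr_pos⟩ := hX_supp
  have hX_le : ∀ᵐ x ∂PX, ∀ t, x t ≤ C := hX_bounded.mono fun x hx t =>
    (hx t).trans (indicator_apply_le' (fun _ => le_rfl) fun _ => hC.le)
  have hΨ_nonneg : ∀ᵐ ω ∂P, ∀ s, 0 ≤ Ψ ω s := hΨ_pos.mono fun ω hω s => (hω s).le
  have hYstar_pos : ∀ᵐ ω ∂P, ∀ t, 0 < Ystar ω t :=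
    hN.ae_forall_pos_of_identDistrib_extremalProcess hμY hΨ hΨ_pos hp hr hr_pos.ne'
      (hcopy.comp measurable_snd)
  have hDb : Bornology.IsBounded D := (hK.add (isCompact_closedBall _ _)).isBounded.subset hDK
  exact mainTheorem9_general PX hX_nonneg hX_le hμY hΨ hΨ_nonneg hp hN hK hYstar
    (hYstar_pos.mono fun ω hω t _ => hω t) hindep hD hDb hh
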